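/- Let $\mathcal P$ be the Poisson point process with unit intensity (Lebesgue measure) on $\mathbb R_+^2=[0,\infty)^2$, viewed as a random set of points $(t,x)$, and let $k\ge 1$ be an integer. A point $a\in\mathbb R_+^2$ is a $k$-corner of $\mathcal P$ if either (I) $a\in\mathcal P$ and exactly $k-1$ points of $\mathcal P$ lie strictly south-west from $a$ (both coordinates strictly smaller), or (II) $a\notin\mathcal P$, exactly $k-2$ points of $\mathcal P$ lie strictly south-west from $a$, some point of $\mathcal P$ lies strictly west from $a$ (same second, smaller first coordinate), and some point of $\mathcal P$ lies strictly south from $a$ (same first, smaller second coordinate). Let $\mathcal C^{(k)}$ be the set of $k$-corners. For $m\ge1$ let $\mathcal C^{(k)}_m$ be the random set of $m$-tuples $(a_1,\dots,a_m)$, $a_i=(t_i,x_i)\in\mathcal C^{(k)}$, such that $t_1<\dots<t_m$, $x_1>\dots>x_m$, and no $k$-corner other than $a_1,\dots,a_m$ has its first coordinate in $(t_1,t_m)$. Let $$p_m(a_1,\dots,a_m)=\frac{k^m}{\Gamma(k)}\,(t_1x_m)^{k-1}\exp\Big[-x_1t_1-\sum_{i=2}^m (t_i-t_{i-1})\,x_{i-1}\Big].$$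 1. For every $m\ge1$, $p_m$ is the joint density of $m$ consecutive $k$-corners: for every Borel set $B\subseteq(\mathbb R^2)^m$ the number of elements of $\mathcal C^{(k)}_m\cap B$ is (up to a null set) a random variable, and $$\mathbb E\,\#\big(\mathcal C^{(k)}_m\cap B\big)=\int_{B\cap D_m}p_m(a_1,\dots,a_m)\,\mathrm da_1\cdots\mathrm da_m,\qquad D_m=\{0<t_1<\dots<t_m,\ x_1>\dots>x_m>0\}.$$ 2. The expression $p_m$ is invariant under the substitution $t_i\leftrightarrow x_{m+1-i}$, $i=1,\dots,m$. 3. For $m=1$, $p_1(t,x)=\frac{k}{\Gamma(k)}(tx)^{k-1}e^{-tx}$, and this is the intensity of $\mathcal C^{(k)}$: for every Borel set $A\subseteq\mathbb R^2$ the number of elements of $\mathcal C^{(k)}\cap A$ is (up to a null set) a random variable, and $$\mathbb E\,\#\big(\mathcal C^{(k)}\cap A\big)=\int_{A\cap\mathbb R_+^2}\frac{k}{\Gamma(k)}(tx)^{k-1}e^{-tx}\,\mathrm dt\,\mathrm dx.$$ -/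

import Mathlib

open MeasureTheory ProbabilityTheory

open scoped ENNReal

noncomputable section

/-- `P` is a Poisson point process on `E` with intensity measure `ν`, viewed as a random set:
the numbers of points in measurable sets are random variables, they are Poisson distributed with
mean `ν A` whenever `ν A` is finite, and they are independent over disjoint sets. -/
structure IsPoissonPointProcess {Ω E : Type*} [MeasurableSpace Ω] [MeasurableSpace E]
    (P : Ω → Set E) (ν : Measure E) (μ : Measure Ω) : Prop where
  measurable_count : ∀ A : Set E, MeasurableSet A → Measurable fun ω => (P ω ∩ A).encard
  hasLaw_count : ∀ A : Set E, MeasurableSet A → ν A ≠ ∞ →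
    HasLaw (fun ω => (P ω ∩ A).encard)
      ((poissonMeasure (ν A).toNNReal).map (fun j : ℕ => (j : ℕ∞))) μ
  indep_count : ∀ (n : ℕ) (A : Fin n → Set E), (∀ i, MeasurableSet (A i)) →
    Pairwise (fun i j => Disjoint (A i) (A j)) →
    iIndepFun (fun i ω => (P ω ∩ A i).encard) μ

/-- The quadrant of points `(t, x)` with `t, x ≥ 0`. -/
def quadrant : Set (ℝ × ℝ) := Set.Ici 0 ×ˢ Set.Ici 0

/-- The points of `S` strictly south-west from `a`. -/
def southWest (S : Set (ℝ × ℝ)) (a : ℝ × ℝ) : Set (ℝ × ℝ) :=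
  {b | b ∈ S ∧ b.1 < a.1 ∧ b.2 < a.2}

/-- `a` is a `k`-corner of `S`: either `a ∈ S` and exactly `k - 1` points of `S` are strictly
south-west from `a`, or `a ∉ S`, exactly `k - 2` points of `S` are strictly south-west from `a`,
some point of `S` is strictly west from `a` and some point of `S` is strictly south from `a`.
(The second alternative never holds for `k = 1`.) -/
def IsKCorner (k : ℕ) (S : Set (ℝ × ℝ)) (a : ℝ × ℝ) : Prop :=
  a ∈ quadrant ∧
    ((a ∈ S ∧ (southWest S a).encard + 1 = k) ∨
     (a ∉ S ∧ (southWest S a).encard + 2 = k ∧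
        (∃ c ∈ S, c.1 < a.1 ∧ c.2 = a.2) ∧ (∃ d ∈ S, d.1 = a.1 ∧ d.2 < a.2)))

/-- The set of `k`-corners of `S`. -/
def corners (k : ℕ) (S : Set (ℝ × ℝ)) : Set (ℝ × ℝ) := {a | IsKCorner k S a}

/-- The tuples `((t₁, x₁), …, (tₘ, xₘ))`, `m = n + 1`, of `k`-corners of `S` with
`t₁ < … < tₘ`, `x₁ > … > xₘ` and no further `k`-corners between the times `t₁` and `tₘ`. -/
def consecutiveCorners (k n : ℕ) (S : Set (ℝ × ℝ)) : Set (Fin (n + 1) → ℝ × ℝ) :=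
  {a | (∀ i, a i ∈ corners k S) ∧
    StrictMono (fun i => (a i).1) ∧ StrictAnti (fun i => (a i).2) ∧
    ∀ c ∈ corners k S, (a 0).1 < c.1 → c.1 < (a (Fin.last n)).1 → c ∈ Set.range a}

/-- The tuples with `0 < t₁ < … < tₘ` and `x₁ > … > xₘ > 0`, `m = n + 1`. -/
def decreasingTuples (n : ℕ) : Set (Fin (n + 1) → ℝ × ℝ) :=
  {a | StrictMono (fun i => (a i).1) ∧ StrictAnti (fun i => (a i).2) ∧
    0 < (a 0).1 ∧ 0 < (a (Fin.last n)).2}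

/-- The expression `k ^ m / Γ(k) * (t₁ xₘ) ^ (k - 1) *
exp (- x₁ t₁ - ∑_{i = 2}^m (tᵢ - tᵢ₋₁) xᵢ₋₁)`, `m = n + 1`. -/
def cornerDensity (k n : ℕ) (a : Fin (n + 1) → ℝ × ℝ) : ℝ :=
  (k : ℝ) ^ (n + 1) / Real.Gamma k * ((a 0).1 * (a (Fin.last n)).2) ^ (k - 1) *
    Real.exp (-((a 0).2 * (a 0).1) -
      ∑ i : Fin n, ((a i.succ).1 - (a i.castSucc).1) * (a i.castSucc).2)

/-- The substitution `tᵢ ↔ xₘ₊₁₋ᵢ`. -/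
def swapTuple {n : ℕ} (a : Fin (n + 1) → ℝ × ℝ) : Fin (n + 1) → ℝ × ℝ :=
  fun i => ((a i.rev).2, (a i.rev).1)

end

open Set Filter Topology

/-! Put k = p + 1 and m = n + 1. Almost surely the points of the process have positive coordinates,
no two share a coordinate, and bounded regions contain finitely many. Then m consecutive k-corners
correspond bijectively to the p + n + 1 points weakly below their staircase, listed by increasing
time. Counting from zero, the i-th corner has the time of the point of index p + i. Its height is
the (p + 1)-th smallest of the heights of the points of index at most p + i. A list of points arises
in this way exactly when each height of index larger than p is below the preceding level and no
other point lies below the staircase (`IsGeneric.image_cornerTuple`, `IsGeneric.injOn_cornerTuple`).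

The expected number of corner tuples is thus an expected number of tuples of points with a region,
depending on the tuple, that contains no further point. By a Mecke formula it is the integral of
exp(-area of the region) over tuples of points (`IsPoissonPointProcess.lintegral_inter_voidTuples`).
The formula is derived from independence of counts by dyadic approximation.

The integrand depends only on the corners, so the other variables integrate out. The p times before
t₁ give t₁^p / p! (`lintegral_increasingTimes`). Among the first p + 1 heights the largest is x₁ and
can stand at any of k indices; deleting it leaves a tuple of the same kind for the remaining
corners, so the heights give k^m xₘ^p (`lintegral_admissibleHeights`). The exponent of the density
is minus the area below the staircase (`volume_underStairs`), and its symmetry is a summation by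
parts. -/

/-! ### Cardinalities and void probabilities. -/

theorem toENNReal_encard_iUnion {α ι : Type*} [Countable ι] {s : ι → Set α}
    (h : Pairwise (Function.onFun Disjoint s)) :
    ((⋃ i, s i).encard : ℝ≥0∞) = ∑' i, ((s i).encard : ℝ≥0∞) := by
  let _ : MeasurableSpace α := ⊤
  have h' := measure_iUnion (μ := Measure.count) h (fun _ => MeasurableSpace.measurableSet_top)
  simpa only [Measure.count_apply MeasurableSpace.measurableSet_top] using h'

theorem tendsto_encard_iUnion {α : Type*} {s : ℕ → Set α} (h : Monotone s) :
    Tendsto (fun j => ((s j).encard : ℝ≥0∞)) atTop (𝓝 ((⋃ j, s j).encard : ℝ≥0∞)) := by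
  let _ : MeasurableSpace α := ⊤
  have h' := tendsto_measure_iUnion_atTop (μ := Measure.count) h
  simpa only [Function.comp_def, Measure.count_apply MeasurableSpace.measurableSet_top] using h'

/-- The probability that a Poisson variable of mean `c` vanishes. -/
noncomputable def expNeg (c : ℝ≥0∞) : ℝ≥0∞ := ENNReal.ofReal (Real.exp (-c.toReal))

theorem expNeg_add {a b : ℝ≥0∞} (ha : a ≠ ∞) (hb : b ≠ ∞) :
    expNeg (a + b) = expNeg a * expNeg b := by
  rw [expNeg, expNeg, expNeg, ← ENNReal.ofReal_mul (Real.exp_nonneg _), ← Real.exp_add,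
    ENNReal.toReal_add ha hb, neg_add]

theorem expNeg_zero : expNeg 0 = 1 := by simp [expNeg]

theorem expNeg_sum {ι : Type*} (s : Finset ι) (f : ι → ℝ≥0∞) (hf : ∀ i ∈ s, f i ≠ ∞) :
    expNeg (∑ i ∈ s, f i) = ∏ i ∈ s, expNeg (f i) := by
  induction s using Finset.cons_induction with
  | empty => simp [expNeg_zero]
  | cons j s hj ih =>
    rw [Finset.sum_cons, Finset.prod_cons, expNeg_add, ih]
    · exact fun i hi => hf i (Finset.mem_cons_of_mem hi)
    · exact hf j (Finset.mem_cons_self j s)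
    · exact ENNReal.sum_ne_top.2 fun i hi => hf i (Finset.mem_cons_of_mem hi)

/-- A point of `S` in `C` outside every `D i` rules out all tuples. Otherwise, covering `S ∩ C`
means that each `D i` inside `C` has no second point, so the tuples form a product. Each factor sees
only one of several disjoint sets, as independence requires. -/
theorem encard_tuples_void {E : Type*} {N : ℕ} (S : Set E) (D : Fin N → Set E) (C : Set E)
    (I : Finset (Fin N)) (hD : Pairwise fun i j => Disjoint (D i) (D j)) (hI : ∀ i ∈ I, D i ⊆ C)
    (hI' : ∀ i ∉ I, Disjoint (D i) C) :
    {z : Fin N → E | (∀ i, z i ∈ S ∩ D i) ∧ S ∩ C ⊆ range z}.encard =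
      (if (S ∩ (C \ ⋃ i, D i)).encard = 0 then 1 else 0) *
      ∏ i, (if i ∈ I then (if (S ∩ D i).encard = 1 then 1 else 0) else (S ∩ D i).encard) := by
  classical
  by_cases h0 : (S ∩ (C \ ⋃ i, D i)).encard = 0
  swap
  · rw [if_neg h0, zero_mul, encard_eq_zero]
    by_contra hne
    obtain ⟨z, hz, hz'⟩ := nonempty_iff_ne_empty.2 hne
    obtain ⟨b, hb, hbC, hbD⟩ := nonempty_iff_ne_empty.2 (mt encard_eq_zero.2 h0)
    obtain ⟨i, rfl⟩ := hz' ⟨hb, hbC⟩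
    exact hbD (mem_iUnion.2 ⟨i, (hz i).2⟩)
  rw [if_pos h0, one_mul]
  by_cases h1 : ∀ i ∈ I, (S ∩ D i).encard = 1
  · have hset : {z : Fin N → E | (∀ i, z i ∈ S ∩ D i) ∧ S ∩ C ⊆ range z} =
        Set.pi univ fun i => S ∩ D i := by
      ext z
      refine ⟨fun h i _ => h.1 i, fun h => ⟨fun i => h i trivial, fun b hb => ?_⟩⟩
      rw [encard_eq_zero] at h0
      by_cases hbD : b ∈ ⋃ i, D i
      · obtain ⟨i, hi⟩ := mem_iUnion.1 hbD
        by_cases hiI : i ∈ I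
        · obtain ⟨c, hc⟩ := encard_eq_one.1 (h1 i hiI)
          have e1 : b ∈ ({c} : Set E) := hc ▸ ⟨hb.1, hi⟩
          have e2 : z i ∈ ({c} : Set E) := hc ▸ h i trivial
          exact ⟨i, e2.trans e1.symm⟩
        · exact absurd hb.2 (disjoint_left.1 (hI' i hiI) hi)
      · exact absurd (show b ∈ S ∩ (C \ ⋃ i, D i) from ⟨hb.1, hb.2, hbD⟩) (by simp [h0])
    rw [hset, encard_pi_eq_prod_encard]
    refine Finset.prod_congr rfl fun i _ => ?_
    by_cases hi : i ∈ I
    · simp [hi, h1 i hi]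
    · simp [hi]
  · push Not at h1
    obtain ⟨i, hi, hne⟩ := h1
    rw [Finset.prod_eq_zero (Finset.mem_univ i) (by simp [hi, hne]), encard_eq_zero]
    by_contra hnem
    obtain ⟨z, hz, hz'⟩ := nonempty_iff_ne_empty.2 hnem
    refine hne (encard_eq_one.2 ⟨z i, Subset.antisymm (fun b hb => ?_) (by simpa using hz i)⟩)
    obtain ⟨j, rfl⟩ := hz' ⟨hb.1, hI i hi hb.2⟩
    by_contra hji
    exact disjoint_left.1 (hD (show i ≠ j from fun h => hji (by simp [h]))) hb.2 (hz j).2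

/-! ### Moments of Poisson counts. -/

section Counts

variable {Ω E : Type*} [MeasurableSpace Ω] [MeasurableSpace E]
  {P : Ω → Set E} {ν : Measure E} {μ : Measure Ω}

theorem IsPoissonPointProcess.lintegral_count (hP : IsPoissonPointProcess P ν μ) {A : Set E}
    (hA : MeasurableSet A) (hν : ν A ≠ ∞) (f : ℕ∞ → ℝ≥0∞) :
    ∫⁻ ω, f (P ω ∩ A).encard ∂μ =
      ∑' j : ℕ, f j * ENNReal.ofReal
        (Real.exp (-(ν A).toReal) * (ν A).toReal ^ j / (j.factorial : ℝ)) := by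
  have h := hP.hasLaw_count A hA hν
  calc ∫⁻ ω, f (P ω ∩ A).encard ∂μ
      = ∫⁻ j, f j ∂(μ.map fun ω => (P ω ∩ A).encard) :=
        (lintegral_map (Measurable.of_discrete) (hP.measurable_count A hA)).symm
    _ = ∫⁻ j : ℕ, f j ∂(poissonMeasure (ν A).toNNReal) := by
        rw [h.map_eq, lintegral_map Measurable.of_discrete Measurable.of_discrete]
    _ = _ := by
        rw [lintegral_countable']
        simp only [poissonMeasure_singleton, ENNReal.coe_toNNReal_eq_toReal]

theorem IsPoissonPointProcess.lintegral_void (hP : IsPoissonPointProcess P ν μ) {A : Set E}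
    (hA : MeasurableSet A) (hν : ν A ≠ ∞) :
    ∫⁻ ω, (if (P ω ∩ A).encard = 0 then 1 else 0) ∂μ = expNeg (ν A) := by
  rw [hP.lintegral_count hA hν (fun j => if j = 0 then 1 else 0), tsum_eq_single 0]
  · simp [expNeg]
  · intro j hj
    simp [hj]

theorem IsPoissonPointProcess.lintegral_one_point (hP : IsPoissonPointProcess P ν μ) {A : Set E}
    (hA : MeasurableSet A) (hν : ν A ≠ ∞) :
    ∫⁻ ω, (if (P ω ∩ A).encard = 1 then 1 else 0) ∂μ = ν A * expNeg (ν A) := by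
  rw [hP.lintegral_count hA hν (fun j => if j = 1 then 1 else 0), tsum_eq_single 1]
  · simp only [Nat.cast_one, if_true, one_mul, pow_one, Nat.factorial_one, div_one]
    rw [mul_comm, ENNReal.ofReal_mul ENNReal.toReal_nonneg, ENNReal.ofReal_toReal hν, expNeg]
  · intro j hj
    simp [hj]

theorem IsPoissonPointProcess.lintegral_encard (hP : IsPoissonPointProcess P ν μ) {A : Set E}
    (hA : MeasurableSet A) (hν : ν A ≠ ∞) :
    ∫⁻ ω, ((P ω ∩ A).encard : ℝ≥0∞) ∂μ = ν A := by
  rw [hP.lintegral_count hA hν (fun j => (j : ℝ≥0∞)), 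
    tsum_eq_zero_add' ENNReal.summable]
  -- Size biasing: j + 1 times the Poisson mass at j + 1 is the mean times the mass at j.
  have h1 : ∀ j : ℕ, (((j + 1 : ℕ) : ℕ∞) : ℝ≥0∞) * ENNReal.ofReal
        (Real.exp (-(ν A).toReal) * (ν A).toReal ^ (j + 1) / ((j + 1).factorial : ℝ)) =
      ν A * ENNReal.ofReal (Real.exp (-(ν A).toReal) * (ν A).toReal ^ j / (j.factorial : ℝ)) := by
    intro j
    rw [ENat.toENNReal_coe, ← ENNReal.ofReal_natCast, ← ENNReal.ofReal_mul (by positivity)]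
    nth_rewrite 3 [← ENNReal.ofReal_toReal hν]
    rw [← ENNReal.ofReal_mul (by positivity)]
    congr 1
    rw [Nat.factorial_succ]
    push_cast
    field_simp
    ring
  simp only [h1]
  rw [ENNReal.tsum_mul_left, ← ENNReal.ofReal_tsum_of_nonneg (fun j => by positivity)]
  · have := (hasSum_one_poissonMeasure (ν A).toNNReal).tsum_eq
    simp only [ENNReal.coe_toNNReal_eq_toReal] at this
    simp [this]
  · have := (hasSum_one_poissonMeasure (ν A).toNNReal).summable
    simpa only [ENNReal.coe_toNNReal_eq_toReal] using this

theorem IsPoissonPointProcess.ae_finite_inter (hP : IsPoissonPointProcess P ν μ) {A : Set E}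
    (hA : MeasurableSet A) (hν : ν A ≠ ∞) : ∀ᵐ ω ∂μ, (P ω ∩ A).Finite := by
  have h : ∀ᵐ ω ∂μ, ((P ω ∩ A).encard : ℝ≥0∞) < ∞ := by
    refine ae_lt_top ?_ ?_
    · exact (Measurable.of_discrete (f := fun j : ℕ∞ => (j : ℝ≥0∞))).comp
        (hP.measurable_count A hA)
    · rwa [hP.lintegral_encard hA hν]
  filter_upwards [h] with ω hω
  rw [← Set.encard_lt_top_iff]
  simpa using hω

theorem IsPoissonPointProcess.ae_inter_eq_empty (hP : IsPoissonPointProcess P ν μ) {A : Set E}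
    (hA : MeasurableSet A) (hν : ν A = 0) : ∀ᵐ ω ∂μ, P ω ∩ A = ∅ := by
  have h := hP.lintegral_encard hA (by simp [hν])
  rw [hν, lintegral_eq_zero_iff] at h
  · filter_upwards [h] with ω hω
    simpa using hω
  · exact (Measurable.of_discrete (f := fun j : ℕ∞ => (j : ℝ≥0∞))).comp
        (hP.measurable_count A hA)

theorem IsPoissonPointProcess.restrict (hP : IsPoissonPointProcess P ν μ) {W : Set E}
    (hW : MeasurableSet W) : IsPoissonPointProcess (fun ω => P ω ∩ W) (ν.restrict W) μ where
  measurable_count A hA := by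
    simp only [inter_assoc]
    exact hP.measurable_count _ (hW.inter hA)
  hasLaw_count A hA h := by
    simp only [inter_assoc]
    rw [Measure.restrict_apply hA, inter_comm A W] at h ⊢
    exact hP.hasLaw_count _ (hW.inter hA) h
  indep_count n A hA hd := by
    simp only [inter_assoc]
    exact hP.indep_count n (fun i => W ∩ A i) (fun i => hW.inter (hA i))
      fun i j hij => (hd hij).mono inter_subset_right inter_subset_right

/-- The count is a product of functions of independent counts. A `D i` inside `C` must hold exactly
one point and contributes ν(D i) exp(-ν(D i)); a `D i` disjoint from `C` contributes its mean ν(D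
i). The exponentials over the pieces of `C` recombine to exp(-ν(C)). -/
theorem IsPoissonPointProcess.lintegral_tuples_void (hP : IsPoissonPointProcess P ν μ)
    [IsFiniteMeasure ν] {N : ℕ} (D : Fin N → Set E) (C : Set E) (I : Finset (Fin N))
    (hDm : ∀ i, MeasurableSet (D i)) (hCm : MeasurableSet C)
    (hD : Pairwise fun i j => Disjoint (D i) (D j)) (hI : ∀ i ∈ I, D i ⊆ C)
    (hI' : ∀ i ∉ I, Disjoint (D i) C) :
    Measurable (fun ω =>
      ({z : Fin N → E | (∀ i, z i ∈ P ω ∩ D i) ∧ P ω ∩ C ⊆ range z}.encard : ℝ≥0∞)) ∧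
    ∫⁻ ω, ({z : Fin N → E | (∀ i, z i ∈ P ω ∩ D i) ∧ P ω ∩ C ⊆ range z}.encard : ℝ≥0∞) ∂μ =
      (∏ i, ν (D i)) * expNeg (ν C) := by
  classical
  let F : Fin (N + 1) → Set E := Fin.cons (C \ ⋃ i, D i) D
  have hF : ∀ i, MeasurableSet (F i) := by
    refine Fin.cases ?_ ?_
    · exact hCm.diff (MeasurableSet.iUnion hDm)
    · exact hDm
  have hFd : Pairwise fun i j => Disjoint (F i) (F j) := by
    have h0 : ∀ i, Disjoint (C \ ⋃ i, D i) (D i) := fun i =>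
      disjoint_left.2 fun b hb hb' => hb.2 (mem_iUnion.2 ⟨i, hb'⟩)
    intro i j
    refine Fin.cases ?_ (fun i => ?_) i <;> refine Fin.cases ?_ (fun j => ?_) j
    · simp
    · exact fun _ => h0 j
    · exact fun _ => (h0 i).symm
    · exact fun h => hD (by simpa using h)
  let g : Fin (N + 1) → ℕ∞ → ℝ≥0∞ := Fin.cons (fun j => if j = 0 then 1 else 0)
    fun i j => if i ∈ I then (if j = 1 then 1 else 0) else j
  have hind : iIndepFun (fun i ω => g i (P ω ∩ F i).encard) μ :=
    (hP.indep_count (N + 1) F hF hFd).comp g fun i => Measurable.of_discrete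
  have hgm : ∀ i, Measurable fun ω => g i (P ω ∩ F i).encard := fun i =>
    (Measurable.of_discrete (f := g i)).comp (hP.measurable_count _ (hF i))
  have key : ∀ ω, ({z : Fin N → E | (∀ i, z i ∈ P ω ∩ D i) ∧ P ω ∩ C ⊆ range z}.encard : ℝ≥0∞) =
      ∏ i, g i (P ω ∩ F i).encard := by
    intro ω
    rw [encard_tuples_void (P ω) D C I hD hI hI', Fin.prod_univ_succ, ENat.toENNReal_mul]
    congr 1
    · simp only [g, F, Fin.cons_zero]
      split_ifs <;> simp
    · change ENat.toENNRealRingHom _ = _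
      rw [map_prod]
      refine Finset.prod_congr rfl fun i _ => ?_
      change ((_ : ℕ∞) : ℝ≥0∞) = _
      simp only [g, F, Fin.cons_succ]
      split_ifs <;> simp
  simp only [key]
  refine ⟨Finset.measurable_fun_prod _ fun i _ => hgm i, ?_⟩
  rw [lintegral_prod_eq_prod_lintegral_of_indepFun _ _ hind hgm, Fin.prod_univ_succ]
  have h0 : ∫⁻ ω, g 0 (P ω ∩ F 0).encard ∂μ = expNeg (ν (C \ ⋃ i, D i)) :=
    hP.lintegral_void (hF 0) (measure_ne_top _ _)
  have h1 : ∀ i : Fin N, ∫⁻ ω, g i.succ (P ω ∩ F i.succ).encard ∂μ =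
      ν (D i) * (if i ∈ I then expNeg (ν (D i)) else 1) := by
    intro i
    simp only [g, F, Fin.cons_succ]
    split_ifs with hi
    · exact hP.lintegral_one_point (hDm i) (measure_ne_top _ _)
    · rw [mul_one]
      exact hP.lintegral_encard (hDm i) (measure_ne_top _ _)
  rw [h0]
  simp only [h1]
  rw [Finset.prod_mul_distrib, mul_left_comm]
  congr 1
  rw [Finset.prod_ite_mem, Finset.univ_inter, ← expNeg_sum _ _ fun i _ => measure_ne_top _ _,
    ← expNeg_add (measure_ne_top _ _) (ENNReal.sum_ne_top.2 fun i _ => measure_ne_top _ _)]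
  congr 1
  rw [← measure_biUnion_finset (fun i _ j _ hij => hD hij) fun i _ => hDm i,
    ← measure_union ?_ (Finset.measurableSet_biUnion _ fun i _ => hDm i)]
  · congr 1
    ext b
    simp only [mem_union, Set.mem_sdiff, mem_iUnion, not_exists]
    constructor
    · rintro (h | ⟨i, hi, hb⟩)
      · exact h.1
      · exact hI i hi hb
    · intro hb
      by_cases h : ∃ i, b ∈ D i
      · obtain ⟨i, hi⟩ := h
        refine Or.inr ⟨i, ?_, hi⟩
        by_contra hiI
        exact disjoint_left.1 (hI' i hiI) hi hb
      · exact Or.inl ⟨hb, fun i hi => h ⟨i, hi⟩⟩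
  · refine disjoint_left.2 fun b hb hb' => hb.2 ?_
    simp only [mem_iUnion] at hb' ⊢
    obtain ⟨i, _, hi⟩ := hb'
    exact ⟨i, hi⟩

end Counts

/-! ### Dyadic approximation of regions depending on a tuple. -/

/-- The index of the dyadic square of side `2⁻ʲ` containing a point. -/
noncomputable def dyadicCell (j : ℕ) (a : ℝ × ℝ) : ℤ × ℤ := (⌊2 ^ j * a.1⌋, ⌊2 ^ j * a.2⌋)

theorem measurable_dyadicCell (j : ℕ) : Measurable (dyadicCell j) := by
  unfold dyadicCell
  fun_prop

theorem floor_two_pow_mul (j : ℕ) (x : ℝ) : ⌊2 ^ j * x⌋ = ⌊2 ^ (j + 1) * x⌋ / 2 := by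
  have h := Int.floor_div_natCast (2 ^ (j + 1) * x) 2
  rw [Nat.cast_ofNat, Nat.cast_ofNat] at h
  rw [← h]
  congr 1
  ring

theorem dyadicCell_eq_of_le {i j : ℕ} (hij : i ≤ j) {a b : ℝ × ℝ}
    (h : dyadicCell j a = dyadicCell j b) : dyadicCell i a = dyadicCell i b := by
  induction j, hij using Nat.le_induction with
  | base => exact h
  | succ j _ ih =>
    refine ih ?_
    simp only [dyadicCell, Prod.mk.injEq] at h ⊢
    simp only [floor_two_pow_mul j, h, and_self]

theorem dist_le_of_dyadicCell_eq {j : ℕ} {a b : ℝ × ℝ} (h : dyadicCell j a = dyadicCell j b) :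
    dist a b ≤ (1 / 2) ^ j := by
  have key : ∀ x y : ℝ, ⌊2 ^ j * x⌋ = ⌊2 ^ j * y⌋ → |x - y| ≤ (1 / 2) ^ j := by
    intro x y hxy
    have := Int.abs_sub_lt_one_of_floor_eq_floor hxy
    rw [← mul_sub, abs_mul, abs_of_pos (by positivity)] at this
    rw [one_div, inv_pow, ← one_div, le_div_iff₀' (by positivity)]
    exact this.le
  simp only [dyadicCell, Prod.mk.injEq] at h
  rw [Prod.dist_eq, Real.dist_eq, Real.dist_eq]
  exact max_le (key _ _ h.1) (key _ _ h.2)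

section Tuples

variable {N : ℕ} (G : Set ((Fin N → ℝ × ℝ) × (ℝ × ℝ)))

/-- The tuples of distinct points `z` of `S` such that all points of `S` in the section of `G`
over `z` are among the entries of `z`. -/
def voidTuples (S : Set (ℝ × ℝ)) : Set (Fin N → ℝ × ℝ) :=
  {z | (∀ i, z i ∈ S) ∧ Function.Injective z ∧ S ∩ {b | (z, b) ∈ G} ⊆ range z}

/-- The union of the dyadic squares which meet a section of `G` over some point of the dyadic
cube with index `c`. -/
def dyadicHull (j : ℕ) (c : Fin N → ℤ × ℤ) : Set (ℝ × ℝ) :=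
  {b | ∃ z' b', (∀ i, dyadicCell j (z' i) = c i) ∧ dyadicCell j b' = dyadicCell j b ∧ (z', b') ∈ G}

/-- The dyadic approximation of `voidTuples`. -/
def dyadicVoidTuples (j : ℕ) (S : Set (ℝ × ℝ)) : Set (Fin N → ℝ × ℝ) :=
  {z | (∀ i, z i ∈ S) ∧ Function.Injective (fun i => dyadicCell j (z i)) ∧
    S ∩ dyadicHull G j (fun i => dyadicCell j (z i)) ⊆ range z}

theorem measurableSet_dyadicHull (j : ℕ) (c : Fin N → ℤ × ℤ) :
    MeasurableSet (dyadicHull G j c) := by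
  have : dyadicHull G j c = dyadicCell j ⁻¹'
      {d | ∃ z' b', (∀ i, dyadicCell j (z' i) = c i) ∧ dyadicCell j b' = d ∧ (z', b') ∈ G} := rfl
  rw [this]
  exact measurable_dyadicCell j (MeasurableSet.of_discrete)

theorem dyadicHull_antitone (z : Fin N → ℝ × ℝ) :
    Antitone fun j => dyadicHull G j (fun i => dyadicCell j (z i)) := by
  rintro i j hij b ⟨z', b', h1, h2, h3⟩
  exact ⟨z', b', fun l => dyadicCell_eq_of_le hij (h1 l), dyadicCell_eq_of_le hij h2, h3⟩

theorem section_subset_dyadicHull (j : ℕ) (z : Fin N → ℝ × ℝ) :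
    {b | (z, b) ∈ G} ⊆ dyadicHull G j (fun i => dyadicCell j (z i)) :=
  fun b hb => ⟨z, b, fun _ => rfl, rfl, hb⟩

variable {G}

/-- Closedness of `G` gives a ball around `(z, b)` missing `G`; once the squares are small, every
pair in the same squares as `(z, b)` lies in this ball. -/
theorem eventually_notMem_dyadicHull (hG : IsClosed G) {z : Fin N → ℝ × ℝ} {b : ℝ × ℝ}
    (h : (z, b) ∉ G) : ∀ᶠ j in atTop, b ∉ dyadicHull G j (fun i => dyadicCell j (z i)) := by
  obtain ⟨ε, hε, hball⟩ := Metric.isOpen_iff.1 hG.isOpen_compl (z, b) h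
  have h2 : ∀ᶠ j : ℕ in atTop, ((1 : ℝ) / 2) ^ j < ε :=
    (tendsto_pow_atTop_nhds_zero_of_lt_one (by norm_num) (by norm_num)).eventually_lt_const hε
  filter_upwards [h2] with j hj
  rintro ⟨z', b', h1, h2, h3⟩
  refine hball ?_ h3
  rw [Metric.mem_ball, Prod.dist_eq]
  refine max_lt (lt_of_le_of_lt ?_ hj) ((dist_le_of_dyadicCell_eq h2).trans_lt hj)
  exact (dist_pi_le_iff (by positivity)).2 fun i => dist_le_of_dyadicCell_eq (h1 i)

theorem eventually_dyadicCell_ne {a b : ℝ × ℝ} (h : a ≠ b) :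
    ∀ᶠ j in atTop, dyadicCell j a ≠ dyadicCell j b := by
  have h2 : ∀ᶠ j : ℕ in atTop, ((1 : ℝ) / 2) ^ j < dist a b :=
    (tendsto_pow_atTop_nhds_zero_of_lt_one (by norm_num) (by norm_num)).eventually_lt_const
      (dist_pos.2 h)
  filter_upwards [h2] with j hj heq
  exact absurd (dist_le_of_dyadicCell_eq heq) (not_le.2 hj)

theorem eventually_injective_dyadicCell {z : Fin N → ℝ × ℝ} (hz : Function.Injective z) :
    ∀ᶠ j in atTop, Function.Injective fun i => dyadicCell j (z i) := by
  have : ∀ᶠ j in atTop, ∀ i l, i ≠ l → dyadicCell j (z i) ≠ dyadicCell j (z l) := by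
    simp only [eventually_all]
    exact fun i l hil => eventually_dyadicCell_ne (hz.ne hil)
  filter_upwards [this] with j hj i l hil
  by_contra hne
  exact hj i l hne hil

theorem injective_of_injective_dyadicCell {j : ℕ} {z : Fin N → ℝ × ℝ}
    (h : Function.Injective fun i => dyadicCell j (z i)) : Function.Injective z :=
  fun _ _ hil => h (congrArg (dyadicCell j) hil)

theorem injective_dyadicCell_mono {i j : ℕ} (hij : i ≤ j) {z : Fin N → ℝ × ℝ}
    (h : Function.Injective fun l => dyadicCell i (z l)) :
    Function.Injective fun l => dyadicCell j (z l) :=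
  fun _ _ hil => h (dyadicCell_eq_of_le hij hil)

variable (G) in
theorem dyadicVoidTuples_mono (S : Set (ℝ × ℝ)) : Monotone fun j => dyadicVoidTuples G j S := by
  rintro i j hij z ⟨h1, h2, h3⟩
  exact ⟨h1, injective_dyadicCell_mono hij h2,
    (inter_subset_inter_right _ (dyadicHull_antitone G z hij)).trans h3⟩

/-- Each point of `S` outside the section leaves the hull at some scale; finiteness of `S` provides
one scale for all of them. -/
theorem iUnion_dyadicVoidTuples (hG : IsClosed G) {S : Set (ℝ × ℝ)} (hS : S.Finite) :
    ⋃ j, dyadicVoidTuples G j S = voidTuples G S := by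
  ext z
  simp only [mem_iUnion]
  constructor
  · rintro ⟨j, h1, h2, h3⟩
    exact ⟨h1, injective_of_injective_dyadicCell h2,
      (inter_subset_inter_right _ (section_subset_dyadicHull G j z)).trans h3⟩
  · rintro ⟨h1, h2, h3⟩
    have h4 : ∀ᶠ j in atTop, ∀ b ∈ S, (z, b) ∉ G →
        b ∉ dyadicHull G j (fun i => dyadicCell j (z i)) := by
      refine (eventually_all_finite hS).2 fun b _ => ?_
      by_cases hb : (z, b) ∈ G
      · simp [hb]
      · filter_upwards [eventually_notMem_dyadicHull hG hb] with j hj _ using hj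
    obtain ⟨j, hj1, hj2⟩ := (h4.and (eventually_injective_dyadicCell h2)).exists
    refine ⟨j, h1, hj2, fun b hb => h3 ⟨hb.1, ?_⟩⟩
    by_contra hbG
    exact hj1 b hb.1 hbG hb.2

variable (G) in
theorem encard_pi_inter_dyadicVoidTuples (j : ℕ) (S : Set (ℝ × ℝ)) (A : Fin N → Set (ℝ × ℝ)) :
    ((Set.pi univ A ∩ dyadicVoidTuples G j S).encard : ℝ≥0∞) =
      ∑' c : {c : Fin N → ℤ × ℤ // Function.Injective c},
        ({z : Fin N → ℝ × ℝ | (∀ i, z i ∈ S ∩ (A i ∩ dyadicCell j ⁻¹' {c.1 i})) ∧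
          S ∩ dyadicHull G j c.1 ⊆ range z}.encard : ℝ≥0∞) := by
  rw [← toENNReal_encard_iUnion]
  · congr 2
    ext z
    simp only [mem_iUnion]
    constructor
    · rintro ⟨h0, h1, h2, h3⟩
      exact ⟨⟨_, h2⟩, fun i => ⟨h1 i, h0 i trivial, rfl⟩, h3⟩
    · rintro ⟨⟨c, hc⟩, h1, h2⟩
      obtain rfl : (fun i => dyadicCell j (z i)) = c := funext fun i => (h1 i).2.2
      exact ⟨fun i _ => (h1 i).2.1, fun i => (h1 i).1, hc, h2⟩
  · intro c c' hne
    refine disjoint_left.2 fun z hz hz' => hne (Subtype.ext (funext fun i => ?_))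
    exact ((hz.1 i).2.2).symm.trans (hz'.1 i).2.2

variable {Ω : Type*} [MeasurableSpace Ω] {P : Ω → Set (ℝ × ℝ)} {ν : Measure (ℝ × ℝ)}
  {μ : Measure Ω}

variable (G) in
-- Fixing the dyadic indices of the entries makes the region constant, so `lintegral_tuples_void`
-- applies to each index and the results are summed. Its hypotheses hold because the hull is a union
-- of dyadic squares: each square is either contained in it or disjoint from it.
theorem IsPoissonPointProcess.lintegral_dyadicVoidTuples (hP : IsPoissonPointProcess P ν μ)
    [IsFiniteMeasure ν] (j : ℕ) {A : Fin N → Set (ℝ × ℝ)} (hA : ∀ i, MeasurableSet (A i)) :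
    Measurable (fun ω => ((Set.pi univ A ∩ dyadicVoidTuples G j (P ω)).encard : ℝ≥0∞)) ∧
    ∫⁻ ω, ((Set.pi univ A ∩ dyadicVoidTuples G j (P ω)).encard : ℝ≥0∞) ∂μ =
      ∫⁻ z in Set.pi univ A ∩ {z | Function.Injective fun i => dyadicCell j (z i)},
        expNeg (ν (dyadicHull G j fun i => dyadicCell j (z i))) ∂(Measure.pi fun _ => ν) := by
  classical
  have hcell : ∀ d, MeasurableSet (dyadicCell j ⁻¹' {d}) := fun d =>
    measurable_dyadicCell j (measurableSet_singleton d)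
  have key := fun c : {c : Fin N → ℤ × ℤ // Function.Injective c} =>
    hP.lintegral_tuples_void (fun i => A i ∩ dyadicCell j ⁻¹' {c.1 i}) (dyadicHull G j c.1)
      (Finset.univ.filter fun i => ∃ b ∈ dyadicHull G j c.1, dyadicCell j b = c.1 i)
      (fun i => (hA i).inter (hcell _)) (measurableSet_dyadicHull G j c.1)
      (fun i l hil => disjoint_left.2 fun b hb hb' =>
        hil (c.2 ((show dyadicCell j b = c.1 i from hb.2).symm.trans hb'.2)))
      (by
        intro i hi b hb
        obtain ⟨b₀, ⟨z', b', h1, h2, h3⟩, h4⟩ := (Finset.mem_filter.1 hi).2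
        exact ⟨z', b', h1, h2.trans (h4.trans hb.2.symm), h3⟩)
      (by
        intro i hi
        refine disjoint_left.2 fun b hb hb' => hi ?_
        exact Finset.mem_filter.2 ⟨Finset.mem_univ _, b, hb', hb.2⟩)
  simp only [encard_pi_inter_dyadicVoidTuples]
  refine ⟨Measurable.tsum fun c => (key c).1, ?_⟩
  rw [lintegral_tsum fun c => (key c).1.aemeasurable]
  have hU : Set.pi univ A ∩ {z | Function.Injective fun i => dyadicCell j (z i)} =
      ⋃ c : {c : Fin N → ℤ × ℤ // Function.Injective c},
        Set.pi univ fun i => A i ∩ dyadicCell j ⁻¹' {c.1 i} := by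
    ext z
    simp only [mem_iUnion]
    constructor
    · rintro ⟨h0, h2⟩
      exact ⟨⟨_, h2⟩, fun i _ => ⟨h0 i trivial, rfl⟩⟩
    · rintro ⟨⟨c, hc⟩, h1⟩
      obtain rfl : (fun i => dyadicCell j (z i)) = c := funext fun i => (h1 i trivial).2
      exact ⟨fun i _ => (h1 i trivial).1, hc⟩
  have hUm : ∀ c : {c : Fin N → ℤ × ℤ // Function.Injective c},
      MeasurableSet (Set.pi univ fun i => A i ∩ dyadicCell j ⁻¹' {c.1 i}) := fun c =>
    MeasurableSet.univ_pi fun i => (hA i).inter (hcell _)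
  rw [hU, lintegral_iUnion hUm]
  · refine tsum_congr fun c => ?_
    rw [(key c).2, setLIntegral_congr_fun (hUm c) (g := fun _ => expNeg (ν (dyadicHull G j c.1)))]
    · rw [setLIntegral_const, Measure.pi_pi, mul_comm]
    · intro z hz
      have : (fun i => dyadicCell j (z i)) = c.1 := funext fun i => (hz i trivial).2
      simp only [this]
  · intro c c' hne
    refine disjoint_left.2 fun z hz hz' => hne (Subtype.ext (funext fun i => ?_))
    exact ((hz i trivial).2).symm.trans (hz' i trivial).2

end Tuples

theorem expNeg_le_expNeg {a b : ℝ≥0∞} (hb : b ≠ ∞) (h : a ≤ b) : expNeg b ≤ expNeg a := by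
  unfold expNeg
  gcongr

theorem expNeg_le_one (a : ℝ≥0∞) : expNeg a ≤ 1 := by
  simp [expNeg]

theorem tendsto_expNeg {ι : Type*} {l : Filter ι} {f : ι → ℝ≥0∞} {a : ℝ≥0∞} (ha : a ≠ ∞)
    (h : Tendsto f l (𝓝 a)) : Tendsto (fun i => expNeg (f i)) l (𝓝 (expNeg a)) :=
  (ENNReal.continuous_ofReal.tendsto _).comp <| (Real.continuous_exp.tendsto _).comp <|
    ((ENNReal.tendsto_toReal ha).comp h).neg

theorem measurableSet_injective {N : ℕ} :
    MeasurableSet {z : Fin N → ℝ × ℝ | Function.Injective z} := by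
  simp only [Function.Injective, ofPred_forall]
  refine MeasurableSet.iInter fun i => MeasurableSet.iInter fun l => ?_
  by_cases h : i = l
  · simp [h]
  · simp only [h, imp_false]
    exact (measurableSet_eq_fun (measurable_pi_apply i) (measurable_pi_apply l)).compl

/-! ### The Mecke formula for tuples with a void region. -/

section Mecke

variable {N : ℕ} {G : Set ((Fin N → ℝ × ℝ) × (ℝ × ℝ))}
variable {Ω : Type*} [MeasurableSpace Ω] {P : Ω → Set (ℝ × ℝ)} {ν : Measure (ℝ × ℝ)}
  {μ : Measure Ω}

theorem iInter_dyadicHull (hG : IsClosed G) (z : Fin N → ℝ × ℝ) :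
    ⋂ j, dyadicHull G j (fun i => dyadicCell j (z i)) = {b | (z, b) ∈ G} := by
  refine Subset.antisymm (fun b hb => ?_) (subset_iInter fun j => section_subset_dyadicHull G j z)
  by_contra h
  obtain ⟨j, hj⟩ := (eventually_notMem_dyadicHull hG h).exists
  exact hj (mem_iInter.1 hb j)

/-- Monotone convergence on both sides: as the mesh is refined, the approximating tuples increase to
the true ones, while the hulls decrease to the section and so their void probabilities increase. -/
theorem IsPoissonPointProcess.lintegral_pi_inter_voidTuples (hP : IsPoissonPointProcess P ν μ)
    [IsFiniteMeasure ν] (hG : IsClosed G) {A : Fin N → Set (ℝ × ℝ)}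
    (hA : ∀ i, MeasurableSet (A i)) :
    AEMeasurable (fun ω => ((Set.pi univ A ∩ voidTuples G (P ω)).encard : ℝ≥0∞)) μ ∧
    ∫⁻ ω, ((Set.pi univ A ∩ voidTuples G (P ω)).encard : ℝ≥0∞) ∂μ =
      ∫⁻ z in Set.pi univ A ∩ {z | Function.Injective z},
        expNeg (ν {b | (z, b) ∈ G}) ∂(Measure.pi fun _ => ν) := by
  have hmono : ∀ S, Monotone fun j => Set.pi univ A ∩ dyadicVoidTuples G j S := fun S i j hij =>
    inter_subset_inter_right _ (dyadicVoidTuples_mono G S hij)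
  have hfin : ∀ᵐ ω ∂μ, (P ω).Finite := by
    simpa using hP.ae_finite_inter MeasurableSet.univ (measure_ne_top _ _)
  have htend : ∀ᵐ ω ∂μ, Tendsto
      (fun j => ((Set.pi univ A ∩ dyadicVoidTuples G j (P ω)).encard : ℝ≥0∞)) atTop
      (𝓝 ((Set.pi univ A ∩ voidTuples G (P ω)).encard : ℝ≥0∞)) := by
    filter_upwards [hfin] with ω hω
    rw [← iUnion_dyadicVoidTuples hG hω, inter_iUnion]
    exact tendsto_encard_iUnion (hmono (P ω))
  have hmeas := fun j => (hP.lintegral_dyadicVoidTuples G j hA).1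
  refine ⟨aemeasurable_of_tendsto_metrizable_ae atTop (fun j => (hmeas j).aemeasurable) htend, ?_⟩
  have hlim := lintegral_tendsto_of_tendsto_of_monotone (fun j => (hmeas j).aemeasurable)
    (ae_of_all _ fun ω i j hij =>
      ENat.toENNReal_mono (encard_le_encard (hmono (P ω) hij))) htend
  refine tendsto_nhds_unique hlim ?_
  simp only [fun j => (hP.lintegral_dyadicVoidTuples G j hA).2]
  have hinj : ∀ j, MeasurableSet
      {z : Fin N → ℝ × ℝ | Function.Injective fun i => dyadicCell j (z i)} := fun j => by
    have : Measurable fun (z : Fin N → ℝ × ℝ) i => dyadicCell j (z i) :=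
      measurable_pi_lambda _ fun i => (measurable_dyadicCell j).comp (measurable_pi_apply i)
    exact this (MeasurableSet.of_discrete (s := {c : Fin N → ℤ × ℤ | Function.Injective c}))
  simp only [inter_comm (Set.pi univ A), ← setLIntegral_indicator (hinj _),
    ← setLIntegral_indicator measurableSet_injective]
  refine lintegral_tendsto_of_tendsto_of_monotone (fun j => ?_) (ae_of_all _ fun z => ?_)
    (ae_of_all _ fun z => ?_)
  · refine Measurable.aemeasurable (Measurable.indicator ?_ (hinj j))
    have : Measurable fun (z : Fin N → ℝ × ℝ) i => dyadicCell j (z i) :=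
      measurable_pi_lambda _ fun i => (measurable_dyadicCell j).comp (measurable_pi_apply i)
    exact (Measurable.of_discrete
      (f := fun c : Fin N → ℤ × ℤ => expNeg (ν (dyadicHull G j c)))).comp this
  · intro i j hij
    simp only [indicator_apply, mem_ofPred_eq]
    split_ifs with h1 h2 h2
    · exact expNeg_le_expNeg (measure_ne_top _ _) (measure_mono (dyadicHull_antitone G z hij))
    · exact absurd (injective_dyadicCell_mono hij h1) h2
    · exact zero_le
    · exact le_rfl
  · by_cases hz : Function.Injective z
    · rw [indicator_of_mem (show z ∈ {z | Function.Injective z} from hz)]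
      have h1 : Tendsto (fun j => expNeg (ν (dyadicHull G j fun i => dyadicCell j (z i)))) atTop
          (𝓝 (expNeg (ν {b | (z, b) ∈ G}))) := by
        refine tendsto_expNeg (measure_ne_top _ _) ?_
        rw [← iInter_dyadicHull hG z]
        exact tendsto_measure_iInter_atTop
          (fun j => (measurableSet_dyadicHull G j _).nullMeasurableSet)
          (dyadicHull_antitone G z) ⟨0, measure_ne_top _ _⟩
      refine h1.congr' ?_
      filter_upwards [eventually_injective_dyadicCell hz] with j hj
      rw [indicator_of_mem (show z ∈ {z | Function.Injective fun i => dyadicCell j (z i)} from hj)]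
    · rw [indicator_of_notMem (show z ∉ {z | Function.Injective z} from hz)]
      refine tendsto_const_nhds.congr fun j => ?_
      rw [indicator_of_notMem]
      exact fun h => hz (injective_of_injective_dyadicCell h)

/-- A π-λ argument starting from product sets. Finiteness of `ν` makes all the expectations finite,
which permits the subtraction for complements. -/
theorem IsPoissonPointProcess.lintegral_inter_voidTuples_of_finite
    (hP : IsPoissonPointProcess P ν μ) [IsFiniteMeasure ν] (hG : IsClosed G)
    {A : Set (Fin N → ℝ × ℝ)} (hA : MeasurableSet A) :
    AEMeasurable (fun ω => ((A ∩ voidTuples G (P ω)).encard : ℝ≥0∞)) μ ∧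
    ∫⁻ ω, ((A ∩ voidTuples G (P ω)).encard : ℝ≥0∞) ∂μ =
      ∫⁻ z in A ∩ {z | Function.Injective z},
        expNeg (ν {b | (z, b) ∈ G}) ∂(Measure.pi fun _ => ν) := by
  have huniv := hP.lintegral_pi_inter_voidTuples hG (A := fun _ => univ) fun _ => MeasurableSet.univ
  rw [pi_univ] at huniv
  have hle : ∀ B : Set (Fin N → ℝ × ℝ),
      ∫⁻ z in B, expNeg (ν {b | (z, b) ∈ G}) ∂(Measure.pi fun _ => ν) ≠ ∞ := by
    intro B
    refine ne_top_of_le_ne_top (measure_ne_top (Measure.pi fun _ => ν) B) ?_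
    calc _ ≤ ∫⁻ z in B, 1 ∂(Measure.pi fun _ => ν) := lintegral_mono fun z => expNeg_le_one _
      _ = _ := by simp
  induction A, hA using MeasurableSpace.induction_on_inter (generateFrom_pi (α := fun _ : Fin N =>
    ℝ × ℝ)).symm isPiSystem_pi with
  | empty => simp
  | basic t ht =>
    obtain ⟨A, hA, rfl⟩ := ht
    exact hP.lintegral_pi_inter_voidTuples hG fun i => hA i trivial
  | compl t htm ih =>
    have hfin : ∀ᵐ ω ∂μ, ((t ∩ voidTuples G (P ω)).encard : ℝ≥0∞) < ∞ :=
      ae_lt_top' ih.1 (by rw [ih.2]; exact hle _)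
    have heq : (fun ω => ((tᶜ ∩ voidTuples G (P ω)).encard : ℝ≥0∞)) =ᵐ[μ] fun ω =>
        ((univ ∩ voidTuples G (P ω)).encard : ℝ≥0∞) - ((t ∩ voidTuples G (P ω)).encard : ℝ≥0∞) := by
      filter_upwards [hfin] with ω hω
      refine ENNReal.eq_sub_of_add_eq hω.ne ?_
      rw [← ENat.toENNReal_add, ← encard_union_eq, ← union_inter_distrib_right, compl_union_self]
      exact (disjoint_compl_left).mono inter_subset_left inter_subset_left
    refine ⟨(huniv.1.sub ih.1).congr heq.symm, ?_⟩
    rw [lintegral_congr_ae heq, lintegral_sub' ih.1 (by rw [ih.2]; exact hle _), huniv.2, ih.2]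
    · refine (ENNReal.eq_sub_of_add_eq (hle _) ?_).symm
      rw [← lintegral_union]
      · rw [← union_inter_distrib_right, compl_union_self]
      · exact htm.inter measurableSet_injective
      · exact (disjoint_compl_left).mono inter_subset_left inter_subset_left
    · exact ae_of_all _ fun ω => ENat.toENNReal_mono
        (encard_le_encard (inter_subset_inter_left _ (subset_univ _)))
  | iUnion f hd hfm ih =>
    have heq : ∀ ω, (((⋃ i, f i) ∩ voidTuples G (P ω)).encard : ℝ≥0∞) =
        ∑' i, ((f i ∩ voidTuples G (P ω)).encard : ℝ≥0∞) := fun ω => by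
      rw [iUnion_inter, toENNReal_encard_iUnion]
      exact fun i j hij => (hd hij).mono inter_subset_left inter_subset_left
    simp only [heq]
    refine ⟨AEMeasurable.tsum fun i => (ih i).1, ?_⟩
    rw [lintegral_tsum fun i => (ih i).1, iUnion_inter, lintegral_iUnion]
    · exact tsum_congr fun i => (ih i).2
    · exact fun i => (hfm i).inter measurableSet_injective
    · exact fun i j hij => (hd hij).mono inter_subset_left inter_subset_left

/-- Expected numbers of tuples of distinct points of a Poisson process on the quadrant which are
alone in a region depending on the tuple. -/
theorem IsPoissonPointProcess.lintegral_inter_voidTuples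
    (hP : IsPoissonPointProcess P ((volume : Measure (ℝ × ℝ)).restrict quadrant) μ)
    (hG : IsClosed G) (hGW : ∀ (M : ℕ) (z : Fin N → ℝ × ℝ),
      (∀ i, z i ∈ Icc 0 (M : ℝ) ×ˢ Icc 0 (M : ℝ)) → ∀ b, (z, b) ∈ G →
        b ∈ Icc 0 (M : ℝ) ×ˢ Icc 0 (M : ℝ))
    {A : Set (Fin N → ℝ × ℝ)} (hA : MeasurableSet A) :
    AEMeasurable (fun ω => ((A ∩ voidTuples G (P ω)).encard : ℝ≥0∞)) μ ∧
    ∫⁻ ω, ((A ∩ voidTuples G (P ω)).encard : ℝ≥0∞) ∂μ =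
      ∫⁻ z in A ∩ {z | Function.Injective z} ∩ Set.pi univ fun _ => quadrant,
        expNeg (volume {b | (z, b) ∈ G}) := by
  set W : ℕ → Set (ℝ × ℝ) := fun M => Icc 0 (M : ℝ) ×ˢ Icc 0 (M : ℝ) with hW
  have hWm : ∀ M, MeasurableSet (W M) := fun M => measurableSet_Icc.prod measurableSet_Icc
  have hWmono : Monotone W := fun M M' h => by
    have : (M : ℝ) ≤ M' := by exact_mod_cast h
    exact prod_mono (Icc_subset_Icc_right this) (Icc_subset_Icc_right this)
  have hWq : ∀ M, W M ⊆ quadrant := fun M => prod_mono Icc_subset_Ici_self Icc_subset_Ici_self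
  have hWU : ⋃ M, W M = quadrant := by
    refine Subset.antisymm (iUnion_subset hWq) fun b hb => ?_
    obtain ⟨M, hM⟩ := exists_nat_ge (max b.1 b.2)
    exact mem_iUnion.2 ⟨M, ⟨hb.1, (le_max_left _ _).trans hM⟩, hb.2, (le_max_right _ _).trans hM⟩
  have hWfin : ∀ M, volume (W M) < ∞ := fun M =>
    (isCompact_Icc.prod isCompact_Icc).measure_lt_top
  have hpiU : ⋃ M, (Set.pi univ fun _ : Fin N => W M) = Set.pi univ fun _ => quadrant := by
    rw [← hWU, iUnion_univ_pi_of_monotone fun _ => hWmono]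
  have hpim : ∀ M, MeasurableSet (Set.pi univ fun _ : Fin N => W M) := fun M =>
    MeasurableSet.univ_pi fun _ => hWm M
  have hpimono : Monotone fun M => (Set.pi univ fun _ : Fin N => W M) := fun M M' h =>
    pi_mono fun _ _ => hWmono h
  have hstep : ∀ M, AEMeasurable (fun ω =>
      ((A ∩ (voidTuples G (P ω) ∩ Set.pi univ fun _ : Fin N => W M)).encard : ℝ≥0∞)) μ ∧
      ∫⁻ ω, ((A ∩ (voidTuples G (P ω) ∩ Set.pi univ fun _ : Fin N => W M)).encard : ℝ≥0∞) ∂μ =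
      ∫⁻ z in A ∩ {z | Function.Injective z} ∩ Set.pi univ fun _ => W M,
        expNeg (volume {b | (z, b) ∈ G}) := by
    intro M
    have hPM := hP.restrict (hWm M)
    rw [Measure.restrict_restrict (hWm M), inter_eq_self_of_subset_left (hWq M)] at hPM
    have : IsFiniteMeasure ((volume : Measure (ℝ × ℝ)).restrict (W M)) :=
      ⟨by simpa using hWfin M⟩
    have h := hPM.lintegral_inter_voidTuples_of_finite hG hA
    -- By `hGW` the region attached to a tuple in the box stays in the box, so points outside the
    -- box cannot violate the void condition.
    have hset : ∀ ω, voidTuples G (P ω ∩ W M) =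
        voidTuples G (P ω) ∩ Set.pi univ fun _ : Fin N => W M := by
      intro ω
      ext z
      constructor
      · rintro ⟨h1, h2, h3⟩
        refine ⟨⟨fun i => (h1 i).1, h2, fun b hb => h3 ⟨⟨hb.1, ?_⟩, hb.2⟩⟩, fun i _ => (h1 i).2⟩
        exact hGW M z (fun i => (h1 i).2) b hb.2
      · rintro ⟨⟨h1, h2, h3⟩, h4⟩
        exact ⟨fun i => ⟨h1 i, h4 i trivial⟩, h2, fun b hb => h3 ⟨hb.1.1, hb.2⟩⟩
    simp only [hset] at h
    refine ⟨h.1, h.2.trans ?_⟩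
    rw [← Measure.restrict_pi_pi, Measure.restrict_restrict (hA.inter measurableSet_injective)]
    refine setLIntegral_congr_fun ((hA.inter measurableSet_injective).inter (hpim M)) ?_
    intro z hz
    simp only
    rw [Measure.restrict_eq_self]
    exact fun b hb => hGW M z (fun i => hz.2 i trivial) b hb
  have hsub : ∀ᵐ ω ∂μ, P ω ⊆ quadrant := by
    have hq : MeasurableSet quadrant := measurableSet_Ici.prod measurableSet_Ici
    filter_upwards [hP.ae_inter_eq_empty hq.compl (by simp [Measure.restrict_apply hq.compl])]
      with ω hω
    rwa [← subset_compl_iff_disjoint_right.trans disjoint_iff_inter_eq_empty, compl_compl] at hω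
  have hmono : ∀ ω, Monotone fun M =>
      A ∩ (voidTuples G (P ω) ∩ Set.pi univ fun _ : Fin N => W M) := fun ω M M' h =>
    inter_subset_inter_right _ (inter_subset_inter_right _ (hpimono h))
  have htend : ∀ᵐ ω ∂μ, Tendsto (fun M =>
      ((A ∩ (voidTuples G (P ω) ∩ Set.pi univ fun _ : Fin N => W M)).encard : ℝ≥0∞)) atTop
      (𝓝 ((A ∩ voidTuples G (P ω)).encard : ℝ≥0∞)) := by
    filter_upwards [hsub] with ω hω
    have : A ∩ voidTuples G (P ω) =
        ⋃ M, A ∩ (voidTuples G (P ω) ∩ Set.pi univ fun _ : Fin N => W M) := by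
      have hsubset : voidTuples G (P ω) ⊆ Set.pi univ fun _ => quadrant :=
        fun z hz i _ => hω (hz.1 i)
      rw [← inter_iUnion, ← inter_iUnion, hpiU, inter_eq_self_of_subset_left hsubset]
    rw [this]
    exact tendsto_encard_iUnion (hmono ω)
  refine ⟨aemeasurable_of_tendsto_metrizable_ae atTop (fun M => (hstep M).1) htend, ?_⟩
  have hlim := lintegral_tendsto_of_tendsto_of_monotone (fun M => (hstep M).1)
    (ae_of_all _ fun ω i j hij =>
      ENat.toENNReal_mono (encard_le_encard (hmono ω hij))) htend
  refine tendsto_nhds_unique hlim ?_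
  simp only [fun M => (hstep M).2]
  rw [← hpiU, inter_iUnion]
  set f := fun z : Fin N → ℝ × ℝ => expNeg (volume {b | (z, b) ∈ G})
  have hm : ∀ M, MeasurableSet
      (A ∩ {z | Function.Injective z} ∩ Set.pi univ fun _ : Fin N => W M) := fun M =>
    (hA.inter measurableSet_injective).inter (hpim M)
  -- Reading the integrals as a measure with density `f` gives continuity from below without
  -- measurability of `f`.
  have := tendsto_measure_iUnion_atTop (μ := volume.withDensity f)
    (s := fun M => A ∩ {z | Function.Injective z} ∩ Set.pi univ fun _ : Fin N => W M)
    fun M M' h => inter_subset_inter_right _ (hpimono h)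
  simp only [Function.comp_def, withDensity_apply _ (hm _),
    withDensity_apply _ (MeasurableSet.iUnion hm)] at this
  exact this

end Mecke

/-! ### Order statistics of the heights. -/

section Level

/-- The sets of `p + 1` indices which are at most `p + l`. -/
def levelSets (p n l : ℕ) : Finset (Finset (Fin (p + n + 1))) :=
  Finset.univ.filter fun s => s.card = p + 1 ∧ ∀ j ∈ s, (j : ℕ) ≤ p + l

theorem card_filter_val_le (p n : ℕ) :
    (Finset.univ.filter fun j : Fin (p + n + 1) => (j : ℕ) ≤ p).card = p + 1 := by
  have := Fin.card_filter_val_lt (n := p + n + 1) (m := p + 1)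
  simp only [Nat.lt_succ_iff] at this
  rw [this]
  omega

theorem levelSets_nonempty (p n l : ℕ) : (levelSets p n l).Nonempty := by
  refine ⟨Finset.univ.filter fun j => (j : ℕ) ≤ p, ?_⟩
  refine Finset.mem_filter.2 ⟨Finset.mem_univ _, card_filter_val_le p n, fun j hj => ?_⟩
  have := (Finset.mem_filter.1 hj).2
  omega

/-- The `(p + 1)`-th smallest of the numbers `y 0, …, y (p + l)`. -/
noncomputable def level (p n : ℕ) (y : Fin (p + n + 1) → ℝ) (l : ℕ) : ℝ :=
  (levelSets p n l).inf' (levelSets_nonempty p n l) fun s =>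
    -- The value 0 is never taken, since the sets have p + 1 elements. The min-max form makes
    -- continuity in `y` immediate.
    if hs : s.Nonempty then s.sup' hs y else 0

variable {p n : ℕ}

theorem nonempty_of_mem_levelSets {l : ℕ} {s : Finset (Fin (p + n + 1))}
    (hs : s ∈ levelSets p n l) : s.Nonempty :=
  Finset.card_pos.1 (by rw [(Finset.mem_filter.1 hs).2.1]; omega)

theorem continuous_level (l : ℕ) : Continuous fun y => level p n y l := by
  refine Continuous.finset_inf'_apply _ fun s hs => ?_
  simp only [nonempty_of_mem_levelSets hs, dif_pos]
  exact Continuous.finset_sup'_apply _ fun j _ => continuous_apply j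

theorem exists_mem_levelSets_iff (l : ℕ) (q : Fin (p + n + 1) → Prop) [DecidablePred q] :
    (∃ s ∈ levelSets p n l, ∀ j ∈ s, q j) ↔
      p + 1 ≤ (Finset.univ.filter fun j : Fin (p + n + 1) => (j : ℕ) ≤ p + l ∧ q j).card := by
  constructor
  · rintro ⟨s, hs, h⟩
    obtain ⟨h1, h2⟩ := (Finset.mem_filter.1 hs).2
    rw [← h1]
    exact Finset.card_le_card fun j hj => Finset.mem_filter.2 ⟨Finset.mem_univ _, h2 j hj, h j hj⟩
  · intro h
    obtain ⟨s, hs, hc⟩ := Finset.exists_subset_card_eq h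
    exact ⟨s, Finset.mem_filter.2 ⟨Finset.mem_univ _, hc, fun j hj =>
      (Finset.mem_filter.1 (hs hj)).2.1⟩, fun j hj => (Finset.mem_filter.1 (hs hj)).2.2⟩

theorem level_le_iff {y : Fin (p + n + 1) → ℝ} {l : ℕ} {c : ℝ} :
    level p n y l ≤ c ↔
      p + 1 ≤ (Finset.univ.filter fun j : Fin (p + n + 1) => (j : ℕ) ≤ p + l ∧ y j ≤ c).card := by
  rw [level, Finset.inf'_le_iff, ← exists_mem_levelSets_iff l fun j => y j ≤ c]
  refine exists_congr fun s => and_congr_right fun hs => ?_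
  rw [dif_pos (nonempty_of_mem_levelSets hs), Finset.sup'_le_iff]

theorem level_lt_iff {y : Fin (p + n + 1) → ℝ} {l : ℕ} {c : ℝ} :
    level p n y l < c ↔
      p + 1 ≤ (Finset.univ.filter fun j : Fin (p + n + 1) => (j : ℕ) ≤ p + l ∧ y j < c).card := by
  rw [level, Finset.inf'_lt_iff, ← exists_mem_levelSets_iff l fun j => y j < c]
  refine exists_congr fun s => and_congr_right fun hs => ?_
  rw [dif_pos (nonempty_of_mem_levelSets hs), Finset.sup'_lt_iff]

theorem exists_eq_level (y : Fin (p + n + 1) → ℝ) (l : ℕ) :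
    ∃ j : Fin (p + n + 1), (j : ℕ) ≤ p + l ∧ y j = level p n y l := by
  obtain ⟨s, hs, h⟩ := Finset.exists_mem_eq_inf' (levelSets_nonempty p n l) fun s =>
    if hs : s.Nonempty then s.sup' hs y else 0
  rw [dif_pos (nonempty_of_mem_levelSets hs)] at h
  obtain ⟨j, hj, h'⟩ := Finset.exists_mem_eq_sup' (nonempty_of_mem_levelSets hs) y
  exact ⟨j, (Finset.mem_filter.1 hs).2.2 j hj, by rw [level, h, h']⟩

theorem level_antitone (y : Fin (p + n + 1) → ℝ) : Antitone (level p n y) := by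
  intro l l' h
  have h0 := level_le_iff.1 (le_refl (level p n y l))
  refine level_le_iff.2 (h0.trans (Finset.card_le_card ?_))
  intro j
  simp only [Finset.mem_filter]
  exact fun hj => ⟨hj.1, by omega, hj.2.2⟩

/-- Fewer than p + 1 entries are strictly below the level, and without ties only one entry equals
it. -/
theorem card_le_level {y : Fin (p + n + 1) → ℝ} (hy : Function.Injective y) (l : ℕ) :
    (Finset.univ.filter fun j : Fin (p + n + 1) =>
      (j : ℕ) ≤ p + l ∧ y j ≤ level p n y l).card = p + 1 := by
  classical
  refine le_antisymm ?_ (level_le_iff.1 le_rfl)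
  obtain ⟨j₀, _, h₀⟩ := exists_eq_level y l
  have h1 : ¬ level p n y l < level p n y l := lt_irrefl _
  rw [level_lt_iff, not_le, Nat.lt_succ_iff] at h1
  refine le_trans (Finset.card_le_card ?_) ((Finset.card_insert_le j₀ _).trans
    (Nat.succ_le_succ h1))
  intro j hj
  simp only [Finset.mem_filter, Finset.mem_insert, Finset.mem_univ, true_and] at hj ⊢
  rcases hj.2.lt_or_eq with h | h
  · exact Or.inr ⟨hj.1, h⟩
  · exact Or.inl (hy (h.trans h₀.symm))

theorem level_zero_lt_iff {y : Fin (p + n + 1) → ℝ} {c : ℝ} :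
    level p n y 0 < c ↔ ∀ j : Fin (p + n + 1), (j : ℕ) ≤ p → y j < c := by
  rw [level_lt_iff]
  constructor
  · intro h j hj
    have hsub : (Finset.univ.filter fun j : Fin (p + n + 1) => (j : ℕ) ≤ p + 0 ∧ y j < c) ⊆
        Finset.univ.filter fun j : Fin (p + n + 1) => (j : ℕ) ≤ p := by
      intro j
      simp only [Finset.mem_filter]
      exact fun hj => ⟨hj.1, hj.2.1⟩
    have heq := Finset.eq_of_subset_of_card_le hsub (by rwa [card_filter_val_le])
    have := heq.symm ▸ (Finset.mem_filter.2 ⟨Finset.mem_univ j, hj⟩ :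
      j ∈ Finset.univ.filter fun j : Fin (p + n + 1) => (j : ℕ) ≤ p)
    exact (Finset.mem_filter.1 this).2.2
  · intro h
    rw [← card_filter_val_le p n]
    refine Finset.card_le_card fun j hj => ?_
    have := (Finset.mem_filter.1 hj).2
    exact Finset.mem_filter.2 ⟨Finset.mem_univ _, by omega, h j this⟩

theorem le_level_zero (y : Fin (p + n + 1) → ℝ) {j : Fin (p + n + 1)} (hj : (j : ℕ) ≤ p) :
    y j ≤ level p n y 0 :=
  le_of_forall_gt fun _ hc => level_zero_lt_iff.1 hc j hj

theorem level_zero_eq_of_forall_lt {i : Fin (p + n + 1)} (hi : (i : ℕ) ≤ p)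
    {y : Fin (p + n + 1) → ℝ} (h : ∀ j : Fin (p + n + 1), (j : ℕ) ≤ p → j ≠ i → y j < y i) :
    level p n y 0 = y i := by
  refine le_antisymm (le_of_forall_gt fun c hc => level_zero_lt_iff.2 fun j hj => ?_)
    (le_level_zero y hi)
  by_cases hji : j = i
  · rwa [hji]
  · exact (h j hj hji).trans hc

theorem val_succAbove_le_iff {N : ℕ} {i : Fin (N + 1)} {j : Fin N} {q : ℕ} (hi : (i : ℕ) ≤ q + 1) :
    (i.succAbove j : ℕ) ≤ q + 1 ↔ (j : ℕ) ≤ q := by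
  rw [Fin.succAbove]
  split_ifs with h
  · have : (j : ℕ) < i := h
    simp only [Fin.val_castSucc]
    omega
  · simp [Fin.val_succ]

/-- The levels of `y` decrease, so `u` exceeds all of them and is never among the p + 1 smallest.
Its insertion at an index at most p only shifts the numbering by one. -/
theorem level_succ_insertNth {i : Fin (p + (n + 1) + 1)} (hi : (i : ℕ) ≤ p) (u : ℝ)
    {y : Fin (p + n + 1) → ℝ} (hu : level p n y 0 < u) (l : ℕ) :
    level p (n + 1) (i.insertNth u y : Fin (p + (n + 1) + 1) → ℝ) (l + 1) = level p n y l := by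
  refine eq_of_forall_ge_iff fun c => ?_
  rw [level_le_iff, level_le_iff]
  have hcard : (Finset.univ.filter fun j : Fin (p + (n + 1) + 1) => (j : ℕ) ≤ p + (l + 1) ∧
      (i.insertNth u y : Fin (p + (n + 1) + 1) → ℝ) j ≤ c).card =
      (if u ≤ c then 1 else 0) +
        (Finset.univ.filter fun j : Fin (p + n + 1) => (j : ℕ) ≤ p + l ∧ y j ≤ c).card := by
    rw [Finset.card_filter, Finset.card_filter]
    refine (Fin.sum_univ_succAbove (n := p + n + 1) _ i).trans ?_
    simp only [Fin.insertNth_apply_same, Fin.insertNth_apply_succAbove]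
    congr 1
    · have : (i : ℕ) ≤ p + (l + 1) := by omega
      simp [this]
    · refine Finset.sum_congr rfl fun j _ => ?_
      have : (i.succAbove j : ℕ) ≤ p + (l + 1) ↔ (j : ℕ) ≤ p + l :=
        val_succAbove_le_iff (i := i) (j := j) (q := p + l) (by omega)
      simp only [this]
  rw [hcard]
  split_ifs with h
  · have h1 : p + 1 ≤ (Finset.univ.filter fun j : Fin (p + n + 1) =>
        (j : ℕ) ≤ p + l ∧ y j ≤ c).card :=
      level_le_iff.1 ((level_antitone y (Nat.zero_le l)).trans (hu.le.trans h))
    omega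
  · rw [zero_add]

end Level

/-! ### Integrating out the early times. -/

section Integrals

theorem measurable_insertNth {N : ℕ} (i : Fin (N + 1)) :
    Measurable fun w : ℝ × (Fin N → ℝ) => (i.insertNth w.1 w.2 : Fin (N + 1) → ℝ) :=
  (MeasurableEquiv.piFinSuccAbove (fun _ => ℝ) i).symm.measurable

theorem measurable_cons {N : ℕ} :
    Measurable fun w : ℝ × (Fin N → ℝ) => (Fin.cons w.1 w.2 : Fin (N + 1) → ℝ) := by
  simpa only [Fin.insertNth_zero'] using measurable_insertNth (N := N) 0

theorem lintegral_insertNth {N : ℕ} (i : Fin (N + 1)) {F : (Fin (N + 1) → ℝ) → ℝ≥0∞}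
    (hF : Measurable F) :
    ∫⁻ y, F y = ∫⁻ u : ℝ, ∫⁻ y' : Fin N → ℝ, F (i.insertNth u y' : Fin (N + 1) → ℝ) := by
  have h := ((volume_preserving_piFinSuccAbove (fun _ : Fin (N + 1) => ℝ) i).symm
    (MeasurableEquiv.piFinSuccAbove (fun _ : Fin (N + 1) => ℝ) i)).lintegral_comp hF
  rw [← h, Measure.volume_eq_prod, lintegral_prod _ (by fun_prop)]
  rfl

theorem lintegral_cons {N : ℕ} {F : (Fin (N + 1) → ℝ) → ℝ≥0∞} (hF : Measurable F) :
    ∫⁻ y, F y = ∫⁻ u : ℝ, ∫⁻ y' : Fin N → ℝ, F (Fin.cons u y' : Fin (N + 1) → ℝ) := by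
  rw [lintegral_insertNth 0 hF]
  simp only [Fin.insertNth_zero']

theorem strictMono_cons_iff {N : ℕ} {u : ℝ} {x : Fin (N + 1) → ℝ} :
    StrictMono (Fin.cons u x : Fin (N + 2) → ℝ) ↔ u < x 0 ∧ StrictMono x :=
  strictMono_vecCons

theorem strictAnti_cons_iff {N : ℕ} {u : ℝ} {x : Fin (N + 1) → ℝ} :
    StrictAnti (Fin.cons u x : Fin (N + 2) → ℝ) ↔ x 0 < u ∧ StrictAnti x :=
  strictAnti_vecCons

theorem measurableSet_strictMono {N : ℕ} : MeasurableSet {x : Fin N → ℝ | StrictMono x} := by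
  simp only [StrictMono, ofPred_forall]
  exact MeasurableSet.iInter fun i => MeasurableSet.iInter fun j => MeasurableSet.iInter fun _ =>
    measurableSet_lt (measurable_pi_apply i) (measurable_pi_apply j)

theorem measurableSet_strictAnti {N : ℕ} : MeasurableSet {x : Fin N → ℝ | StrictAnti x} := by
  simp only [StrictAnti, ofPred_forall]
  exact MeasurableSet.iInter fun i => MeasurableSet.iInter fun j => MeasurableSet.iInter fun _ =>
    measurableSet_lt (measurable_pi_apply j) (measurable_pi_apply i)

/-- The increasing tuples of positive numbers. -/
def increasingTimes (N : ℕ) : Set (Fin (N + 1) → ℝ) := {s | StrictMono s ∧ 0 < s 0}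

theorem measurableSet_increasingTimes (N : ℕ) : MeasurableSet (increasingTimes N) :=
  measurableSet_strictMono.inter (measurableSet_lt measurable_const (measurable_pi_apply 0))

theorem lintegral_Ioo_pow_div_factorial (q : ℕ) {c : ℝ} (hc : 0 ≤ c) :
    ∫⁻ u in Ioo 0 c, ENNReal.ofReal (u ^ q / q.factorial) =
      ENNReal.ofReal (c ^ (q + 1) / (q + 1).factorial) := by
  rw [← ofReal_integral_eq_lintegral_ofReal]
  · rw [← integral_Ioc_eq_integral_Ioo, ← intervalIntegral.integral_of_le hc,
      intervalIntegral.integral_div, integral_pow, Nat.factorial_succ]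
    congr 1
    push_cast
    have : (q.factorial : ℝ) ≠ 0 := by positivity
    field_simp
    simp
  · exact ((continuous_pow q).div_const _).integrableOn_Icc.mono_set Ioo_subset_Icc_self
  · filter_upwards [ae_restrict_mem measurableSet_Ioo] with u hu
    have := hu.1.le
    positivity

/-- The times are integrated out from the earliest on: the first one ranges over `(0, s 0)` and
turns the weight of degree q into that of degree q + 1. Hence q must be free in the induction; the
separate variable `M` avoids casts between index types. -/
theorem lintegral_increasingTimes_aux (n p : ℕ) : ∀ (M : ℕ) (hM : M = p + n) (q : ℕ)
    (g : (Fin (n + 1) → ℝ) → ℝ≥0∞), Measurable g →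
    ∫⁻ s in increasingTimes M, ENNReal.ofReal (s 0 ^ q / q.factorial) *
        g (fun i => s ⟨p + i, by omega⟩) =
      ∫⁻ t in increasingTimes n, ENNReal.ofReal (t 0 ^ (q + p) / (q + p).factorial) * g t := by
  induction p with
  | zero =>
    intro M hM q g _
    obtain rfl : M = n := by omega
    simp
  | succ p ih =>
    intro M hM q g hg
    obtain ⟨M, rfl⟩ : ∃ M', M = M' + 1 := ⟨p + n, by omega⟩
    have hM' : M = p + n := by omega
    have hmeas : Measurable fun s : Fin (M + 1 + 1) → ℝ =>
        ENNReal.ofReal (s 0 ^ q / q.factorial) * g (fun i => s ⟨p + 1 + i, by omega⟩) :=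
      (by fun_prop : Measurable fun s : Fin (M + 1 + 1) → ℝ =>
        ENNReal.ofReal (s 0 ^ q / q.factorial)).mul
        (hg.comp (measurable_pi_lambda _ fun i => measurable_pi_apply _))
    have hmeas2 : Measurable fun s : Fin (M + 1) → ℝ => g (fun i => s ⟨p + i, by omega⟩) :=
      hg.comp (measurable_pi_lambda _ fun i => measurable_pi_apply _)
    rw [← lintegral_indicator (measurableSet_increasingTimes _),
      lintegral_cons (hmeas.indicator (measurableSet_increasingTimes _)),
      lintegral_lintegral_swap]
    · have hin : ∀ s : Fin (M + 1) → ℝ, ∫⁻ u : ℝ, (increasingTimes (M + 1)).indicator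
          (fun s => ENNReal.ofReal (s 0 ^ q / q.factorial) * g (fun i => s ⟨p + 1 + i, by omega⟩))
          (Fin.cons u s : Fin (M + 1 + 1) → ℝ) = (increasingTimes M).indicator
          (fun s => ENNReal.ofReal (s 0 ^ (q + 1) / (q + 1).factorial) *
            g (fun i => s ⟨p + i, by omega⟩)) s := by
        intro s
        have hshift : ∀ u, (fun i : Fin (n + 1) => (Fin.cons u s : Fin (M + 1 + 1) → ℝ)
            ⟨p + 1 + i, by omega⟩) = fun i : Fin (n + 1) => s ⟨p + i, by omega⟩ := by
          intro u
          funext i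
          have : (⟨p + 1 + i, by omega⟩ : Fin (M + 1 + 1)) =
              Fin.succ ⟨p + i, by omega⟩ := by
            ext
            simp
            omega
          rw [this, Fin.cons_succ]
        by_cases hs : s ∈ increasingTimes M
        · rw [indicator_of_mem hs, ← lintegral_Ioo_pow_div_factorial q hs.2.le,
            ← lintegral_mul_const _ (by fun_prop), ← lintegral_indicator measurableSet_Ioo]
          refine lintegral_congr fun u => ?_
          by_cases hu : u ∈ Ioo 0 (s 0)
          · rw [indicator_of_mem hu, indicator_of_mem, hshift, Fin.cons_zero]
            exact ⟨strictMono_cons_iff.2 ⟨hu.2, hs.1⟩, hu.1⟩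
          · rw [indicator_of_notMem hu, indicator_of_notMem]
            rintro ⟨h1, h2⟩
            exact hu ⟨h2, (strictMono_cons_iff.1 h1).1⟩
        · rw [indicator_of_notMem hs, ← lintegral_zero]
          refine lintegral_congr fun u => ?_
          rw [indicator_of_notMem]
          rintro ⟨h1, h2⟩
          obtain ⟨h3, h4⟩ := strictMono_cons_iff.1 h1
          exact hs ⟨h4, lt_trans h2 h3⟩
      simp only [hin]
      rw [lintegral_indicator (measurableSet_increasingTimes _), ih M hM' (q + 1) g hg]
      simp only [show q + 1 + p = q + (p + 1) by omega]
    · refine ((hmeas.indicator (measurableSet_increasingTimes _)).comp ?_).aemeasurable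
      exact measurable_cons

theorem lintegral_increasingTimes (n p : ℕ) {g : (Fin (n + 1) → ℝ) → ℝ≥0∞} (hg : Measurable g) :
    ∫⁻ s in increasingTimes (p + n), g (fun i => s ⟨p + i, by omega⟩) =
      ∫⁻ t in increasingTimes n, ENNReal.ofReal (t 0 ^ p / p.factorial) * g t := by
  simpa using lintegral_increasingTimes_aux n p (p + n) rfl 0 g hg

end Integrals

/-! ### Integrating out the heights that are not levels. -/

section Heights

theorem ae_injective_pi (N : ℕ) : ∀ᵐ y : Fin N → ℝ, Function.Injective y := by
  have h : ∀ i j : Fin N, i ≠ j → ∀ᵐ y : Fin N → ℝ, y i ≠ y j := by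
    intro i j hij
    let L : Submodule ℝ (Fin N → ℝ) :=
      LinearMap.ker (LinearMap.proj (R := ℝ) (φ := fun _ : Fin N => ℝ) i - LinearMap.proj j)
    have hL : L ≠ ⊤ := by
      intro htop
      have : Pi.single i (1 : ℝ) ∈ L := htop ▸ Submodule.mem_top
      simp [L, hij.symm] at this
    have h0 := Measure.addHaar_submodule volume L hL
    rw [ae_iff]
    refine measure_mono_null (fun y hy => ?_) h0
    simp only [not_not] at hy
    have hy' : y i = y j := hy
    simp [L, hy']
  have h' : ∀ᵐ y : Fin N → ℝ, ∀ i j : Fin N, i ≠ j → y i ≠ y j := by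
    simp only [eventually_all]
    exact h
  filter_upwards [h'] with y hy i j hij
  by_contra hne
  exact hy i j hne hij

/-- The tuples whose largest entry among those of index at most `p` is the one of index `i`. -/
def maxAt (p : ℕ) {N : ℕ} (i : Fin N) : Set (Fin N → ℝ) :=
  {y | ∀ j : Fin N, (j : ℕ) ≤ p → j ≠ i → y j < y i}

theorem measurableSet_maxAt (p : ℕ) {N : ℕ} (i : Fin N) : MeasurableSet (maxAt p i) := by
  simp only [maxAt, ofPred_forall]
  exact MeasurableSet.iInter fun j => MeasurableSet.iInter fun _ => MeasurableSet.iInter fun _ =>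
    measurableSet_lt (measurable_pi_apply j) (measurable_pi_apply i)

/-- Off the null set of tuples with ties, exactly one of the first p + 1 entries is the largest. -/
theorem lintegral_eq_sum_maxAt (p n : ℕ) (F : (Fin (p + n + 1) → ℝ) → ℝ≥0∞) :
    ∫⁻ y, F y = ∑ i ∈ Finset.univ.filter (fun i : Fin (p + n + 1) => (i : ℕ) ≤ p),
      ∫⁻ y in maxAt p i, F y := by
  rw [← lintegral_biUnion_finset]
  · rw [← setLIntegral_univ]
    refine setLIntegral_congr ?_
    refine (eventuallyEq_univ.2 ?_).symm
    filter_upwards [ae_injective_pi (p + n + 1)] with y hy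
    obtain ⟨i, hi, hmax⟩ := Finset.exists_max_image
      (Finset.univ.filter fun i : Fin (p + n + 1) => (i : ℕ) ≤ p) y
      ⟨0, by simp⟩
    refine mem_iUnion₂.2 ⟨i, hi, fun j hj hji => ?_⟩
    exact lt_of_le_of_ne (hmax j (by simpa using hj)) (hy.ne hji)
  · intro i hi j hj hij
    refine disjoint_left.2 fun y hyi hyj => ?_
    simp only [Finset.coe_filter, Finset.mem_univ, true_and] at hi hj
    exact lt_asymm (hyi j hj hij.symm) (hyj i hi hij)
  · exact fun i _ => measurableSet_maxAt p i

/-- The decreasing tuples of positive numbers. -/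
def decreasingHeights (n : ℕ) : Set (Fin (n + 1) → ℝ) := {x | StrictAnti x ∧ 0 < x (Fin.last n)}

theorem measurableSet_decreasingHeights (n : ℕ) : MeasurableSet (decreasingHeights n) :=
  measurableSet_strictAnti.inter (measurableSet_lt measurable_const (measurable_pi_apply _))

/-- The tuples of positive numbers each entry of which, from the index `p + 1` on, is smaller than
the `(p + 1)`-th smallest of the preceding ones. -/
def admissibleHeights (p n : ℕ) : Set (Fin (p + n + 1) → ℝ) :=
  {y | (∀ j, 0 < y j) ∧ ∀ (j : Fin (p + n + 1)) (l : ℕ), (j : ℕ) = p + l + 1 → y j < level p n y l}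

theorem measurableSet_admissibleHeights (p n : ℕ) : MeasurableSet (admissibleHeights p n) := by
  simp only [admissibleHeights, ofPred_and, ofPred_forall]
  refine (MeasurableSet.iInter fun j => measurableSet_lt measurable_const
    (measurable_pi_apply j)).inter (MeasurableSet.iInter fun j => MeasurableSet.iInter fun l =>
    MeasurableSet.iInter fun _ => ?_)
  exact measurableSet_lt (measurable_pi_apply j) (continuous_level l).measurable

/-- The tuple of the levels. -/
noncomputable def levels (p n : ℕ) (y : Fin (p + n + 1) → ℝ) : Fin (n + 1) → ℝ :=
  fun i => level p n y i

theorem continuous_levels (p n : ℕ) : Continuous (levels p n) :=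
  continuous_pi fun i => continuous_level i

variable {p n : ℕ}

/-- The deleted entry `u` is the level of index 0 of the long tuple. The first p + 1 entries of `y`
are the old entries of index at most p + 1 other than `u`: those up to p are below `u` by
maximality, and the one of index p + 1 by admissibility. Together this says that the first level of
`y` is below `u`; the later conditions match by `level_succ_insertNth`. -/
theorem insertNth_mem_iff {i : Fin (p + (n + 1) + 1)} (hi : (i : ℕ) ≤ p) {u : ℝ}
    {y : Fin (p + n + 1) → ℝ} :
    (i.insertNth u y : Fin (p + (n + 1) + 1) → ℝ) ∈ maxAt p i ∩ admissibleHeights p (n + 1) ↔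
      y ∈ admissibleHeights p n ∧ level p n y 0 < u := by
  set Y : Fin (p + (n + 1) + 1) → ℝ := i.insertNth u y with hY
  have hYi : Y i = u := Fin.insertNth_apply_same (α := fun _ => ℝ) i u y
  have hYs : ∀ j : Fin (p + n + 1), Y (i.succAbove j) = y j := fun j =>
    Fin.insertNth_apply_succAbove (α := fun _ => ℝ) i u y j
  constructor
  · rintro ⟨h1, h2, h3⟩
    have hl0 : level p (n + 1) Y 0 = u := by
      rw [level_zero_eq_of_forall_lt hi h1, hYi]
    have hlt : level p n y 0 < u := by
      refine level_zero_lt_iff.2 fun j hj => ?_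
      rw [← hYs j]
      have hle : (i.succAbove j : ℕ) ≤ p + 1 := (val_succAbove_le_iff (by omega)).2 hj
      rcases Nat.lt_or_ge p (i.succAbove j : ℕ) with h | h
      · have := h3 (i.succAbove j) 0 (by omega)
        rwa [hl0] at this
      · have := h1 (i.succAbove j) h (Fin.succAbove_ne i j)
        rwa [hYi] at this
    refine ⟨⟨fun j => hYs j ▸ h2 _, fun j l hj => ?_⟩, hlt⟩
    rw [← hYs j, ← level_succ_insertNth hi u hlt l]
    refine h3 _ (l + 1) ?_
    have : ¬ (i.succAbove j : ℕ) ≤ p + l + 1 := by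
      rw [val_succAbove_le_iff (by omega)]
      omega
    have : (i.succAbove j : ℕ) ≤ p + (l + 1) + 1 := (val_succAbove_le_iff (by omega)).2 (by omega)
    omega
  · rintro ⟨⟨h1, h2⟩, h3⟩
    have hu : 0 < u := (h1 0).trans ((level_zero_lt_iff.1 h3) 0 (by simp))
    have hmax : Y ∈ maxAt p i := by
      intro j hj hji
      obtain ⟨j', rfl⟩ := Fin.exists_succAbove_eq hji
      rw [hYs, hYi]
      exact level_zero_lt_iff.1 h3 j'
        ((val_succAbove_le_iff (i := i) (j := j') (by omega)).1 (by omega))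
    have hl0 : level p (n + 1) Y 0 = u := by
      rw [level_zero_eq_of_forall_lt hi hmax, hYi]
    refine ⟨hmax, fun j => ?_, fun j l hj => ?_⟩
    · by_cases hji : j = i
      · rw [hji, hYi]
        exact hu
      · obtain ⟨j', rfl⟩ := Fin.exists_succAbove_eq hji
        rw [hYs]
        exact h1 j'
    · have hji : j ≠ i := by
        rintro rfl
        omega
      obtain ⟨j', rfl⟩ := Fin.exists_succAbove_eq hji
      rw [hYs]
      have hle : (j' : ℕ) ≤ p + l := (val_succAbove_le_iff (by omega)).1 hj.le
      cases l with
      | zero =>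
        rw [hl0]
        exact level_zero_lt_iff.1 h3 j' hle
      | succ l =>
        rw [hY, level_succ_insertNth hi u h3 l]
        refine h2 j' l ?_
        have : ¬ (j' : ℕ) ≤ p + l := by
          rw [← val_succAbove_le_iff (i := i) (by omega)]
          omega
        omega

theorem levels_insertNth {i : Fin (p + (n + 1) + 1)} (hi : (i : ℕ) ≤ p) {u : ℝ}
    {y : Fin (p + n + 1) → ℝ}
    (h : (i.insertNth u y : Fin (p + (n + 1) + 1) → ℝ) ∈ maxAt p i) (hu : level p n y 0 < u) :
    levels p (n + 1) (i.insertNth u y : Fin (p + (n + 1) + 1) → ℝ) = Fin.cons u (levels p n y) := by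
  funext l
  refine Fin.cases ?_ (fun l => ?_) l
  · rw [Fin.cons_zero]
    refine (level_zero_eq_of_forall_lt hi h).trans ?_
    exact Fin.insertNth_apply_same (α := fun _ => ℝ) i u y
  · rw [Fin.cons_succ]
    exact level_succ_insertNth hi u hu l

/-- The only level is the maximum u of p + 1 heights. It can stand at p + 1 indices, and the other p
heights fill a cube of volume u^p. -/
theorem lintegral_admissibleHeights_zero (p : ℕ) {h : (Fin 1 → ℝ) → ℝ≥0∞} (hh : Measurable h) :
    ∫⁻ y in admissibleHeights p 0, h (levels p 0 y) =
      ∫⁻ x in decreasingHeights 0, ((p + 1 : ℕ) : ℝ≥0∞) * ENNReal.ofReal (x 0 ^ p) * h x := by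
  have hm : Measurable ((admissibleHeights p 0).indicator fun y => h (levels p 0 y)) :=
    (hh.comp (continuous_levels p 0).measurable).indicator (measurableSet_admissibleHeights p 0)
  have hterm : ∀ i : Fin (p + 0 + 1), (i : ℕ) ≤ p →
      ∫⁻ y in maxAt p i, (admissibleHeights p 0).indicator (fun y => h (levels p 0 y)) y =
      ∫⁻ u in Ioi (0 : ℝ), ENNReal.ofReal (u ^ p) * h (fun _ => u) := by
    intro i hi
    rw [← lintegral_indicator (measurableSet_maxAt p i),
      lintegral_insertNth i (hm.indicator (measurableSet_maxAt p i)),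
      ← lintegral_indicator measurableSet_Ioi]
    refine lintegral_congr fun u => ?_
    have hfun : ∀ y : Fin (p + 0) → ℝ, (maxAt p i).indicator
        ((admissibleHeights p 0).indicator fun y => h (levels p 0 y))
        (i.insertNth u y : Fin (p + 0 + 1) → ℝ) =
        (Ioi (0 : ℝ)).indicator (fun u => (Set.pi univ fun _ : Fin (p + 0) => Ioo 0 u).indicator
          (fun _ => h (fun _ => u)) y) u := by
      intro y
      set Y : Fin (p + 0 + 1) → ℝ := i.insertNth u y with hY
      have hYi : Y i = u := Fin.insertNth_apply_same (α := fun _ => ℝ) i u y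
      have hYs : ∀ j : Fin (p + 0), Y (i.succAbove j) = y j := fun j =>
        Fin.insertNth_apply_succAbove (α := fun _ => ℝ) i u y j
      by_cases hmem : Y ∈ maxAt p i ∧ Y ∈ admissibleHeights p 0
      · have hu : u ∈ Ioi (0 : ℝ) := hYi ▸ hmem.2.1 i
        rw [indicator_of_mem hmem.1, indicator_of_mem hmem.2, indicator_of_mem hu, indicator_of_mem]
        · congr 1
          funext l
          obtain rfl : l = 0 := Fin.ext (by omega)
          exact (level_zero_eq_of_forall_lt (p := p) (n := 0) hi hmem.1).trans hYi
        · refine fun j _ => ⟨hYs j ▸ hmem.2.1 _, ?_⟩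
          rw [← hYs j, ← hYi]
          exact hmem.1 _ (by omega) (Fin.succAbove_ne i j)
      · rw [show (maxAt p i).indicator ((admissibleHeights p 0).indicator fun y =>
            h (levels p 0 y)) Y = 0 by
          by_cases h1 : Y ∈ maxAt p i
          · rw [indicator_of_mem h1, indicator_of_notMem fun h2 => hmem ⟨h1, h2⟩]
          · rw [indicator_of_notMem h1]]
        symm
        by_cases hu : u ∈ Ioi (0 : ℝ)
        · rw [indicator_of_mem hu, indicator_of_notMem]
          intro hy
          refine hmem ⟨fun j _ hji => ?_, fun j => ?_, fun j l hj => by omega⟩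
          · obtain ⟨j', rfl⟩ := Fin.exists_succAbove_eq hji
            rw [hYs, hYi]
            exact (hy j' trivial).2
          · by_cases hji : j = i
            · rw [hji, hYi]
              exact hu
            · obtain ⟨j', rfl⟩ := Fin.exists_succAbove_eq hji
              rw [hYs]
              exact (hy j' trivial).1
        · rw [indicator_of_notMem hu]
    simp only [hfun]
    by_cases hu : u ∈ Ioi (0 : ℝ)
    · simp only [indicator_of_mem hu]
      change ∫⁻ y : Fin p → ℝ, (Set.pi univ fun _ : Fin p => Ioo 0 u).indicator
        (fun _ => h fun _ => u) y = _
      rw [lintegral_indicator (MeasurableSet.univ_pi fun _ => measurableSet_Ioo),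
        setLIntegral_const, volume_pi_pi, mul_comm]
      simp [ENNReal.ofReal_pow (le_of_lt hu)]
    · simp only [indicator_of_notMem hu, lintegral_zero]
  have hmR : Measurable fun x : Fin (0 + 1) → ℝ => ((p + 1 : ℕ) : ℝ≥0∞) *
      ENNReal.ofReal (x 0 ^ p) * h x :=
    (by fun_prop : Measurable fun x : Fin (0 + 1) → ℝ => ((p + 1 : ℕ) : ℝ≥0∞) *
      ENNReal.ofReal (x 0 ^ p)).mul hh
  rw [← lintegral_indicator (measurableSet_admissibleHeights p 0),
    lintegral_eq_sum_maxAt p 0,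
    Finset.sum_congr rfl fun i hi => hterm i (Finset.mem_filter.1 hi).2, Finset.sum_const,
    card_filter_val_le p 0, nsmul_eq_mul, ← lintegral_indicator (measurableSet_decreasingHeights 0),
    lintegral_cons (hmR.indicator (measurableSet_decreasingHeights 0)), ← lintegral_const_mul _ (by fun_prop),
    ← lintegral_indicator measurableSet_Ioi]
  refine lintegral_congr fun u => ?_
  have hv : volume (univ : Set (Fin 0 → ℝ)) = 1 := by
    rw [← pi_univ univ, volume_pi_pi]
    simp
  have hcons : ∀ y : Fin 0 → ℝ, (Fin.cons u y : Fin 1 → ℝ) = fun _ => u := fun y => by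
    funext l
    obtain rfl : l = 0 := Fin.ext (by omega)
    rfl
  simp only [hcons, lintegral_const, hv, mul_one]
  by_cases hu : u ∈ Ioi (0 : ℝ)
  · rw [indicator_of_mem hu, indicator_of_mem, mul_assoc]
    refine ⟨fun a b hab => ?_, hu⟩
    have : (a : ℕ) < b := hab
    omega
  · rw [indicator_of_notMem hu, indicator_of_notMem]
    exact fun h => hu h.2

/-- Induction on the number of levels. Deleting the maximum of the first p + 1 heights removes the
first level and shifts the others. The resulting integral is the same for each of the p + 1 possible
indices, which yields one more factor p + 1. -/
theorem lintegral_admissibleHeights (p n : ℕ) : ∀ {h : (Fin (n + 1) → ℝ) → ℝ≥0∞}, Measurable h →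
    ∫⁻ y in admissibleHeights p n, h (levels p n y) =
      ∫⁻ x in decreasingHeights n,
        ((p + 1 : ℕ) : ℝ≥0∞) ^ (n + 1) * ENNReal.ofReal (x (Fin.last n) ^ p) * h x := by
  induction n with
  | zero =>
    intro h hh
    rw [lintegral_admissibleHeights_zero p hh]
    simp
  | succ n ih =>
    intro h hh
    have hm : Measurable ((admissibleHeights p (n + 1)).indicator fun y =>
        h (levels p (n + 1) y)) :=
      (hh.comp (continuous_levels p (n + 1)).measurable).indicator
        (measurableSet_admissibleHeights p (n + 1))
    have hcm : ∀ u : ℝ, Measurable fun x : Fin (n + 1) → ℝ => h (Fin.cons u x) := fun u =>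
      hh.comp (measurable_cons.comp measurable_prodMk_left)
    have hlt : ∀ u : ℝ, MeasurableSet {x : Fin (n + 1) → ℝ | x 0 < u} := fun u =>
      measurableSet_lt (measurable_pi_apply 0) measurable_const
    have hterm : ∀ i : Fin (p + (n + 1) + 1), (i : ℕ) ≤ p →
        ∫⁻ y in maxAt p i, (admissibleHeights p (n + 1)).indicator
          (fun y => h (levels p (n + 1) y)) y =
        ∫⁻ u : ℝ, ∫⁻ x in decreasingHeights n, ((p + 1 : ℕ) : ℝ≥0∞) ^ (n + 1) *
          ENNReal.ofReal (x (Fin.last n) ^ p) *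
            {x : Fin (n + 1) → ℝ | x 0 < u}.indicator (fun x => h (Fin.cons u x)) x := by
      intro i hi
      rw [← lintegral_indicator (measurableSet_maxAt p i)]
      refine (lintegral_insertNth i (hm.indicator (measurableSet_maxAt p i))).trans ?_
      refine lintegral_congr fun u => ?_
      rw [← ih ((hcm u).indicator (hlt u)),
        ← lintegral_indicator (measurableSet_admissibleHeights p n)]
      refine lintegral_congr fun y => ?_
      have hiff := insertNth_mem_iff hi (u := u) (y := y)
      rw [indicator_indicator]
      by_cases hy : y ∈ admissibleHeights p n ∧ level p n y 0 < u
      · have hmem := hiff.2 hy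
        rw [indicator_of_mem hmem, indicator_of_mem hy.1, indicator_of_mem,
          levels_insertNth hi hmem.1 hy.2]
        exact hy.2
      · rw [indicator_of_notMem (mt hiff.1 hy)]
        symm
        by_cases hy1 : y ∈ admissibleHeights p n
        · rw [indicator_of_mem hy1, indicator_of_notMem
            (show levels p n y ∉ {x : Fin (n + 1) → ℝ | x 0 < u} from fun h2 => hy ⟨hy1, h2⟩)]
        · rw [indicator_of_notMem hy1]
    have hmR : Measurable fun x : Fin (n + 1 + 1) → ℝ => ((p + 1 : ℕ) : ℝ≥0∞) ^ (n + 1 + 1) *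
        ENNReal.ofReal (x (Fin.last (n + 1)) ^ p) * h x :=
      (by fun_prop : Measurable fun x : Fin (n + 1 + 1) → ℝ => ((p + 1 : ℕ) : ℝ≥0∞) ^ (n + 1 + 1) *
        ENNReal.ofReal (x (Fin.last (n + 1)) ^ p)).mul hh
    rw [← lintegral_indicator (measurableSet_admissibleHeights p (n + 1)), lintegral_eq_sum_maxAt,
      Finset.sum_congr rfl fun i hi => hterm i (Finset.mem_filter.1 hi).2, Finset.sum_const,
      card_filter_val_le, nsmul_eq_mul,
      ← lintegral_indicator (measurableSet_decreasingHeights (n + 1)),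
      lintegral_cons (hmR.indicator (measurableSet_decreasingHeights (n + 1))),
      ← lintegral_const_mul' _ _ (by simp)]
    refine lintegral_congr fun u => ?_
    rw [← lintegral_const_mul' _ _ (by simp),
      ← lintegral_indicator (measurableSet_decreasingHeights n)]
    refine lintegral_congr fun x => ?_
    have hiff : (Fin.cons u x : Fin (n + 1 + 1) → ℝ) ∈ decreasingHeights (n + 1) ↔
        x ∈ decreasingHeights n ∧ x 0 < u := by
      simp only [decreasingHeights, mem_ofPred_eq, strictAnti_cons_iff, ← Fin.succ_last,
        Fin.cons_succ]
      tauto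
    by_cases hx : x ∈ decreasingHeights n ∧ x 0 < u
    · rw [indicator_of_mem (hiff.2 hx), indicator_of_mem hx.1, indicator_of_mem
        (show x ∈ {x : Fin (n + 1) → ℝ | x 0 < u} from hx.2), ← Fin.succ_last, Fin.cons_succ,
        pow_succ' _ (n + 1)]
      simp only [mul_assoc]
    · rw [indicator_of_notMem (mt hiff.1 hx)]
      by_cases hx1 : x ∈ decreasingHeights n
      · rw [indicator_of_mem hx1, indicator_of_notMem
          (show x ∉ {x : Fin (n + 1) → ℝ | x 0 < u} from fun h2 => hx ⟨hx1, h2⟩)]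
        simp
      · rw [indicator_of_notMem hx1]

end Heights

/-! ### Corners and staircases of generic configurations. -/

section Generic

/-- The points of `S` weakly south-west from `a`. -/
def weakSouthWest (S : Set (ℝ × ℝ)) (a : ℝ × ℝ) : Set (ℝ × ℝ) :=
  {b | b ∈ S ∧ b.1 ≤ a.1 ∧ b.2 ≤ a.2}

/-- A set of points in the open quadrant, finite in bounded regions, no two points of which share a
coordinate. -/
structure IsGeneric (S : Set (ℝ × ℝ)) : Prop where
  pos : ∀ a ∈ S, 0 < a.1 ∧ 0 < a.2
  fst_inj : ∀ a ∈ S, ∀ b ∈ S, a.1 = b.1 → a = b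
  snd_inj : ∀ a ∈ S, ∀ b ∈ S, a.2 = b.2 → a = b
  finite : ∀ a, (weakSouthWest S a).Finite

variable {S : Set (ℝ × ℝ)} {k p n : ℕ}

/-- Without shared coordinates, the closed box below `a` exceeds the open one by its edge points
only: `a` itself in the first type, one point on the top edge and one on the right edge in the
second. Counting in the closed box therefore merges both types into one condition. -/
theorem IsGeneric.isKCorner_iff (hS : IsGeneric S) {a : ℝ × ℝ} :
    IsKCorner k S a ↔ (weakSouthWest S a).encard = k ∧ (∃ c ∈ S, c.1 ≤ a.1 ∧ c.2 = a.2) ∧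
      ∃ d ∈ S, d.1 = a.1 ∧ d.2 ≤ a.2 := by
  have typeI : a ∈ S → (weakSouthWest S a).encard = (southWest S a).encard + 1 := by
    intro ha
    have : weakSouthWest S a = insert a (southWest S a) := by
      ext b
      constructor
      · rintro ⟨h1, h2, h3⟩
        by_cases hba : b = a
        · exact Or.inl hba
        · exact Or.inr ⟨h1, lt_of_le_of_ne h2 fun h => hba (hS.fst_inj b h1 a ha h),
            lt_of_le_of_ne h3 fun h => hba (hS.snd_inj b h1 a ha h)⟩
      · rintro (rfl | ⟨h1, h2, h3⟩)
        · exact ⟨ha, le_rfl, le_rfl⟩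
        · exact ⟨h1, h2.le, h3.le⟩
    rw [this, encard_insert_of_notMem fun h => lt_irrefl _ h.2.1]
  have typeII : ∀ c ∈ S, ∀ d ∈ S, c.1 < a.1 → c.2 = a.2 → d.1 = a.1 → d.2 < a.2 →
      (weakSouthWest S a).encard = (southWest S a).encard + 2 := by
    intro c hc d hd hc1 hc2 hd1 hd2
    have : weakSouthWest S a = insert c (insert d (southWest S a)) := by
      ext b
      constructor
      · rintro ⟨h1, h2, h3⟩
        by_cases hbc : b = c
        · exact Or.inl hbc
        by_cases hbd : b = d
        · exact Or.inr (Or.inl hbd)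
        · exact Or.inr (Or.inr ⟨h1,
            lt_of_le_of_ne h2 fun h => hbd (hS.fst_inj b h1 d hd (h.trans hd1.symm)),
            lt_of_le_of_ne h3 fun h => hbc (hS.snd_inj b h1 c hc (h.trans hc2.symm))⟩)
      · rintro (rfl | rfl | ⟨h1, h2, h3⟩)
        · exact ⟨hc, hc1.le, hc2.le⟩
        · exact ⟨hd, hd1.le, hd2.le⟩
        · exact ⟨h1, h2.le, h3.le⟩
    have hcd : c ≠ d := by
      rintro rfl
      exact hc1.ne hd1
    rw [this, encard_insert_of_notMem, encard_insert_of_notMem, add_assoc, one_add_one_eq_two]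
    · exact fun h => h.2.1.ne hd1
    · rintro (h | h)
      · exact hcd h
      · exact h.2.2.ne hc2
  constructor
  · rintro ⟨-, ⟨ha, h⟩ | ⟨-, h, ⟨c, hc, hc1, hc2⟩, d, hd, hd1, hd2⟩⟩
    · exact ⟨(typeI ha).trans h, ⟨a, ha, le_rfl, rfl⟩, a, ha, rfl, le_rfl⟩
    · exact ⟨(typeII c hc d hd hc1 hc2 hd1 hd2).trans h, ⟨c, hc, hc1.le, hc2⟩, d, hd, hd1, hd2.le⟩
  · rintro ⟨h, ⟨c, hc, hc1, hc2⟩, d, hd, hd1, hd2⟩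
    refine ⟨⟨hd1 ▸ (hS.pos d hd).1.le, hc2 ▸ (hS.pos c hc).2.le⟩, ?_⟩
    by_cases hcd : c = d
    · subst hcd
      have ha : a ∈ S := by
        have : c = a := Prod.ext hd1 hc2
        rwa [← this]
      exact Or.inl ⟨ha, (typeI ha).symm.trans h⟩
    · have hc1' : c.1 < a.1 :=
        lt_of_le_of_ne hc1 fun h => hcd (hS.fst_inj c hc d hd (h.trans hd1.symm))
      have hd2' : d.2 < a.2 :=
        lt_of_le_of_ne hd2 fun h => hcd (hS.snd_inj c hc d hd (hc2.trans h.symm))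
      refine Or.inr ⟨fun ha => ?_, (typeII c hc d hd hc1' hc2 hd1 hd2').symm.trans h,
        ⟨c, hc, hc1', hc2⟩, d, hd, hd1, hd2'⟩
      exact hc1'.ne (congrArg Prod.fst (hS.snd_inj c hc a ha hc2))

/-- The `k`-corners form an antichain. -/
theorem IsGeneric.corner_eq_of_le (hS : IsGeneric S) {a c : ℝ × ℝ} (ha : IsKCorner k S a)
    (hc : IsKCorner k S c) (h1 : a.1 ≤ c.1) (h2 : a.2 ≤ c.2) : a = c := by
  obtain ⟨ha0, -, -⟩ := hS.isKCorner_iff.1 ha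
  obtain ⟨hc0, ⟨w, hw, hw1, hw2⟩, d, hd, hd1, hd2⟩ := hS.isKCorner_iff.1 hc
  -- Nested boxes with equally many points contain the same points, so the smaller box reaches the
  -- edge points `w` and `d` of the larger one.
  have heq : weakSouthWest S a = weakSouthWest S c :=
    (hS.finite c).eq_of_subset_of_encard_le'
      (fun b hb => ⟨hb.1, hb.2.1.trans h1, hb.2.2.trans h2⟩) (by rw [ha0, hc0])
  have hwa : w ∈ weakSouthWest S a := by
    rw [heq]
    exact ⟨hw, hw1, hw2.le⟩
  have hda : d ∈ weakSouthWest S a := by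
    rw [heq]
    exact ⟨hd, hd1.le, hd2⟩
  exact Prod.ext (le_antisymm h1 (hd1 ▸ hda.2.1)) (le_antisymm h2 (hw2 ▸ hwa.2.2))

/-- The region below the staircase given by a tuple of points. -/
def underStairs (a : Fin (n + 1) → ℝ × ℝ) : Set (ℝ × ℝ) :=
  {b | 0 ≤ b.1 ∧ 0 ≤ b.2 ∧ ((b.1 ≤ (a 0).1 ∧ b.2 ≤ (a 0).2) ∨
    -- Each strip keeps the height of the earlier corner; a point strictly inside it would create an
    -- intermediate corner.
    ∃ l : Fin n, (a l.castSucc).1 ≤ b.1 ∧ b.1 ≤ (a l.succ).1 ∧ b.2 ≤ (a l.castSucc).2)}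

theorem exists_step_of_lt {f : Fin (n + 1) → ℝ} {v : ℝ} (h0 : f 0 < v) (i : Fin (n + 1))
    (hi : v ≤ f i) : ∃ l : Fin n, l.succ ≤ i ∧ f l.castSucc < v ∧ v ≤ f l.succ := by
  induction i using Fin.induction with
  | zero => exact absurd hi (not_le.2 h0)
  | succ i ih =>
    rcases lt_or_ge (f i.castSucc) v with h | h
    · exact ⟨i, le_rfl, h, hi⟩
    · obtain ⟨l, hl, hl'⟩ := ih h
      exact ⟨l, hl.trans i.castSucc_lt_succ.le, hl'⟩

theorem mem_underStairs {a : Fin (n + 1) → ℝ × ℝ} (ha : Antitone fun i => (a i).2) {b : ℝ × ℝ}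
    (hb : 0 < b.1 ∧ 0 < b.2) {i : Fin (n + 1)} (h1 : b.1 ≤ (a i).1) (h2 : b.2 ≤ (a i).2) :
    b ∈ underStairs a := by
  refine ⟨hb.1.le, hb.2.le, ?_⟩
  rcases le_or_gt b.1 (a 0).1 with h | h
  · exact Or.inl ⟨h, h2.trans (ha (Fin.zero_le i))⟩
  · obtain ⟨l, hl, hl1, hl2⟩ := exists_step_of_lt (f := fun i => (a i).1) h i h1
    exact Or.inr ⟨l, hl1.le, hl2, h2.trans (ha (l.castSucc_lt_succ.le.trans hl))⟩

/-- The tuple of corners determined by a tuple of points in the order of time. -/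
noncomputable def cornerTuple (p n : ℕ) (z : Fin (p + n + 1) → ℝ × ℝ) : Fin (n + 1) → ℝ × ℝ :=
  fun i => ((z ⟨p + i, by omega⟩).1, level p n (fun j => (z j).2) i)

/-- The pairs of a tuple of points and a point below the staircase of its corners. -/
def stairsGraph (p n : ℕ) : Set ((Fin (p + n + 1) → ℝ × ℝ) × (ℝ × ℝ)) :=
  {w | w.2 ∈ underStairs (cornerTuple p n w.1)}

/-- The tuples of points in the order of time which can produce consecutive corners. -/
def admissibleTuples (p n : ℕ) : Set (Fin (p + n + 1) → ℝ × ℝ) :=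
  {z | (fun j => (z j).1) ∈ increasingTimes (p + n) ∧ (fun j => (z j).2) ∈ admissibleHeights p n}

/-- Among the p + 1 entries up to the old level, exchange the top one for the new entry, which is
below that level by admissibility. This gives p + 1 entries strictly below it. -/
theorem level_succ_lt {y : Fin (p + n + 1) → ℝ} (hinj : Function.Injective y)
    (hy : y ∈ admissibleHeights p n) {l : ℕ} (hl : l < n) :
    level p n y (l + 1) < level p n y l := by
  classical
  obtain ⟨j₀, hj₀, h₀⟩ := exists_eq_level y l
  set F := Finset.univ.filter fun j : Fin (p + n + 1) => (j : ℕ) ≤ p + l ∧ y j ≤ level p n y l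
  have hF : F.card = p + 1 := card_le_level hinj l
  let j₁ : Fin (p + n + 1) := ⟨p + l + 1, by omega⟩
  have hj₁ : j₁ ∉ F.erase j₀ := by
    intro h
    have := (Finset.mem_filter.1 (Finset.mem_of_mem_erase h)).2.1
    simp only [j₁] at this
    omega
  have hcard : (insert j₁ (F.erase j₀)).card = p + 1 := by
    rw [Finset.card_insert_of_notMem hj₁, Finset.card_erase_of_mem, hF]
    · omega
    · exact Finset.mem_filter.2 ⟨Finset.mem_univ _, hj₀, h₀.le⟩
  rw [level_lt_iff, ← hcard]
  refine Finset.card_le_card fun j hj => Finset.mem_filter.2 ⟨Finset.mem_univ _, ?_⟩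
  rcases Finset.mem_insert.1 hj with rfl | hj
  · exact ⟨by simp only [j₁]; omega, hy.2 _ l rfl⟩
  · obtain ⟨hne, hjF⟩ := Finset.mem_erase.1 hj
    obtain ⟨h1, h2⟩ := (Finset.mem_filter.1 hjF).2
    exact ⟨by omega, lt_of_le_of_ne h2 fun h => hne (hinj (h.trans h₀.symm))⟩

/-- If the newest entry exceeded the current level, it would not affect that level, which would then
equal or exceed the previous one, against `level_succ_lt`. -/
theorem le_level_of_admissible {y : Fin (p + n + 1) → ℝ} (hinj : Function.Injective y)
    (hy : y ∈ admissibleHeights p n) {j : Fin (p + n + 1)} {l : ℕ} (hj : (j : ℕ) = p + l) :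
    y j ≤ level p n y l := by
  cases l with
  | zero => exact le_level_zero y (by omega)
  | succ l =>
    by_contra! hlt
    refine absurd (level_succ_lt hinj hy (l := l) (by omega)) (not_lt.2 ?_)
    have h0 := level_le_iff.1 (le_refl (level p n y (l + 1)))
    refine level_le_iff.2 (h0.trans (Finset.card_le_card fun i hi => ?_))
    obtain ⟨h1, h2⟩ := (Finset.mem_filter.1 hi).2
    refine Finset.mem_filter.2 ⟨Finset.mem_univ _, ?_, h2⟩
    by_contra hil
    have : i = j := Fin.ext (by omega)
    exact absurd h2 (not_le.2 (this ▸ hlt))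

theorem encard_image_filter {α ι : Type*} [Fintype ι] {z : ι → α} (hz : Function.Injective z)
    (q : ι → Prop) [DecidablePred q] :
    (z '' {j | q j}).encard = ((Finset.univ.filter q).card : ℕ∞) := by
  rw [hz.encard_image, ← encard_coe_eq_coe_finsetCard]
  simp

end Generic

/-! ### The bijection between tuples of points and consecutive corners. -/

section Bijection

variable {S : Set (ℝ × ℝ)} {p n : ℕ}

theorem IsGeneric.snd_injective (hS : IsGeneric S) {z : Fin (p + n + 1) → ℝ × ℝ}
    (hz : z ∈ voidTuples (stairsGraph p n) S) : Function.Injective fun j => (z j).2 :=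
  fun i j h => hz.2.1 (hS.snd_inj _ (hz.1 i) _ (hz.1 j) h)

theorem IsGeneric.strictAnti_cornerTuple (hS : IsGeneric S) {z : Fin (p + n + 1) → ℝ × ℝ}
    (hA : z ∈ admissibleTuples p n) (hz : z ∈ voidTuples (stairsGraph p n) S) :
    StrictAnti fun i => (cornerTuple p n z i).2 :=
  Fin.strictAnti_iff_succ_lt.2 fun i => level_succ_lt (hS.snd_injective hz) hA.2 i.2

theorem strictMono_cornerTuple {z : Fin (p + n + 1) → ℝ × ℝ} (hA : z ∈ admissibleTuples p n) :
    StrictMono fun i => (cornerTuple p n z i).1 := fun i j hij =>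
  hA.1.1 (show (⟨p + i, by omega⟩ : Fin (p + n + 1)) < ⟨p + j, by omega⟩ from
    Nat.add_lt_add_left hij p)

/-- The box of a corner lies below the staircase apart from points on the axes, so all its points
are entries of `z`; the order of times bounds their indices. -/
theorem IsGeneric.weakSouthWest_cornerTuple (hS : IsGeneric S) {z : Fin (p + n + 1) → ℝ × ℝ}
    (hA : z ∈ admissibleTuples p n) (hz : z ∈ voidTuples (stairsGraph p n) S) (i : Fin (n + 1)) :
    weakSouthWest S (cornerTuple p n z i) =
      z '' {j | (j : ℕ) ≤ p + i ∧ (z j).2 ≤ level p n (fun j => (z j).2) i} := by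
  ext b
  constructor
  · rintro ⟨h1, h2, h3⟩
    obtain ⟨j, rfl⟩ := hz.2.2 ⟨h1, mem_underStairs (hS.strictAnti_cornerTuple hA hz).antitone
      (hS.pos b h1) h2 h3⟩
    refine ⟨j, ⟨?_, h3⟩, rfl⟩
    by_contra hj
    exact absurd h2 (not_le.2 (hA.1.1 (show (⟨p + i, by omega⟩ : Fin (p + n + 1)) < j from
      not_le.1 hj)))
  · rintro ⟨j, ⟨h1, h2⟩, rfl⟩
    exact ⟨hz.1 j, hA.1.1.monotone (show j ≤ (⟨p + i, by omega⟩ : Fin (p + n + 1)) from h1), h2⟩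

theorem IsGeneric.isKCorner_cornerTuple (hS : IsGeneric S) {z : Fin (p + n + 1) → ℝ × ℝ}
    (hA : z ∈ admissibleTuples p n) (hz : z ∈ voidTuples (stairsGraph p n) S) (i : Fin (n + 1)) :
    IsKCorner (p + 1) S (cornerTuple p n z i) := by
  have hy := hS.snd_injective hz
  refine hS.isKCorner_iff.2 ⟨?_, ?_, ?_⟩
  · rw [hS.weakSouthWest_cornerTuple hA hz i, encard_image_filter hz.2.1, card_le_level hy i]
  · obtain ⟨j, hj, h⟩ := exists_eq_level (fun j => (z j).2) (i : ℕ)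
    exact ⟨z j, hz.1 j,
      hA.1.1.monotone (show j ≤ (⟨p + i, by omega⟩ : Fin (p + n + 1)) from hj), h⟩
  · exact ⟨z ⟨p + i, by omega⟩, hz.1 _, rfl, le_level_of_admissible hy hA.2 rfl⟩

theorem IsGeneric.cornerTuple_mem (hS : IsGeneric S) {z : Fin (p + n + 1) → ℝ × ℝ}
    (hA : z ∈ admissibleTuples p n) (hz : z ∈ voidTuples (stairsGraph p n) S) :
    cornerTuple p n z ∈ consecutiveCorners (p + 1) n S := by
  have hcor := hS.isKCorner_cornerTuple hA hz
  have hmono := strictMono_cornerTuple hA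
  refine ⟨hcor, hmono, hS.strictAnti_cornerTuple hA hz, fun c hc h0 hn => ?_⟩
  obtain ⟨l, -, hl1, hl2⟩ :=
    exists_step_of_lt (f := fun i => (cornerTuple p n z i).1) h0 (Fin.last n) hn.le
  rcases hl2.lt_or_eq with hl2 | hl2
  -- Let `d` be the point on the right edge of an intermediate corner. If it lies below the step, it
  -- is an entry of `z` with index strictly between two consecutive integers. If it lies above, the
  -- corner dominates corner `l`, against the antichain property.
  · exfalso
    obtain ⟨-, -, d, hd, hd1, hd2⟩ := hS.isKCorner_iff.1 hc
    rcases le_or_gt d.2 (cornerTuple p n z l.castSucc).2 with h | h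
    · obtain ⟨j, rfl⟩ := hz.2.2 ⟨hd, (hS.pos d hd).1.le, (hS.pos d hd).2.le,
        Or.inr ⟨l, hd1 ▸ hl1.le, hd1 ▸ hl2.le, h⟩⟩
      rw [← hd1] at hl1 hl2
      have h1 : (⟨p + l, by omega⟩ : Fin (p + n + 1)) < j := hA.1.1.lt_iff_lt.1 hl1
      have h2 : j < (⟨p + (l + 1), by omega⟩ : Fin (p + n + 1)) := hA.1.1.lt_iff_lt.1 hl2
      rw [Fin.lt_def] at h1 h2
      simp only at h1 h2
      omega
    · exact hl1.ne (congrArg Prod.fst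
        (hS.corner_eq_of_le (hcor l.castSucc) hc hl1.le (h.le.trans hd2)))
  · refine ⟨l.succ, ?_⟩
    rcases le_total c.2 (cornerTuple p n z l.succ).2 with h | h
    · exact (hS.corner_eq_of_le hc (hcor l.succ) hl2.le h).symm
    · exact hS.corner_eq_of_le (hcor l.succ) hc hl2.ge h

theorem IsGeneric.range_eq_iUnion (hS : IsGeneric S) {z : Fin (p + n + 1) → ℝ × ℝ}
    (hA : z ∈ admissibleTuples p n) (hz : z ∈ voidTuples (stairsGraph p n) S) :
    range z = ⋃ i, weakSouthWest S (cornerTuple p n z i) := by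
  have hy := hS.snd_injective hz
  refine Subset.antisymm ?_ (iUnion_subset fun i => ?_)
  · rintro _ ⟨j, rfl⟩
    rcases Nat.lt_or_ge p j with h | h
    · refine mem_iUnion.2 ⟨⟨j - p, by omega⟩, ?_⟩
      rw [hS.weakSouthWest_cornerTuple hA hz]
      refine ⟨j, ⟨?_, le_level_of_admissible hy hA.2 ?_⟩, rfl⟩ <;> simp only <;> omega
    · refine mem_iUnion.2 ⟨0, ?_⟩
      rw [hS.weakSouthWest_cornerTuple hA hz]
      exact ⟨j, ⟨by simpa using h, le_level_zero (fun j => (z j).2) h⟩, rfl⟩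
  · rw [hS.weakSouthWest_cornerTuple hA hz]
    exact image_subset_range _ _

/-- The corners determine the set of points as the union of their boxes, and the increasing times
determine the order. -/
theorem IsGeneric.injOn_cornerTuple (hS : IsGeneric S) :
    InjOn (cornerTuple p n) (admissibleTuples p n ∩ voidTuples (stairsGraph p n) S) := by
  rintro z ⟨hA, hz⟩ z' ⟨hA', hz'⟩ heq
  have hrange : range z = range z' := by
    rw [hS.range_eq_iUnion hA hz, hS.range_eq_iUnion hA' hz', heq]
  have hfst : range (fun j => (z j).1) = range fun j => (z' j).1 := by
    have := congrArg (fun s => Prod.fst '' s) hrange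
    simpa only [← range_comp, Function.comp_def] using this
  have hfun : (fun j => (z j).1) = fun j => (z' j).1 := (hA.1.1.range_inj hA'.1.1).1 hfst
  funext j
  exact hS.fst_inj _ (hz.1 j) _ (hz'.1 j) (congrFun hfun j)

/-- No point lies below the staircase strictly between the times of consecutive corners. -/
theorem IsGeneric.not_between (hS : IsGeneric S) {a : Fin (n + 1) → ℝ × ℝ}
    (ha : a ∈ consecutiveCorners (p + 1) n S) (l : Fin n) {b : ℝ × ℝ} (hb : b ∈ S)
    (h1 : (a l.castSucc).1 < b.1) (h2 : b.1 < (a l.succ).1) : (a l.castSucc).2 < b.2 := by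
  classical
  by_contra! h3
  obtain ⟨hcor, hmono, hanti, hno⟩ := ha
  set x := (a l.castSucc).2
  set t := (a l.castSucc).1
  obtain ⟨hcard, ⟨w, hw, hw1, hw2⟩, -⟩ := hS.isKCorner_iff.1 (hcor l.castSucc)
  let Q : Set (ℝ × ℝ) := {b | b ∈ S ∧ t < b.1 ∧ b.1 < (a l.succ).1 ∧ b.2 ≤ x}
  have hQ : Q.Finite := (hS.finite ((a l.succ).1, x)).subset
    fun b hb => ⟨hb.1, hb.2.2.1.le, hb.2.2.2⟩
  -- Among the offending points take the earliest one.
  obtain ⟨b₀, ⟨hb₀S, hb₀1, hb₀2, hb₀3⟩, hmin⟩ := hQ.exists_minimalFor Prod.fst Q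
    ⟨b, hb, h1, h2, h3⟩
  have hmin' : ∀ b ∈ Q, b₀.1 ≤ b.1 := fun b hb => (le_total b₀.1 b.1).elim id (hmin hb)
  set C := weakSouthWest S (a l.castSucc)
  have hb₀C : b₀ ∉ C := fun h => absurd h.2.1 (not_le.2 hb₀1)
  have hwC : w ∈ C := ⟨hw, hw1, hw2.le⟩
  -- Exchanging the top point `w` for `b₀` keeps p + 1 points. The box with right edge through `b₀`
  -- and top edge through the highest point of `K` contains exactly `K`, so its vertex is a corner
  -- at a forbidden time.
  let K : Set (ℝ × ℝ) := insert b₀ (C \ {w})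
  have hKfin : K.Finite := ((hS.finite _).subset sdiff_subset).insert _
  have hKcard : K.encard = (p + 1 : ℕ) := by
    rw [encard_insert_of_notMem fun h => hb₀C h.1, encard_sdiff_singleton_add_one hwC, hcard]
  have hKx : ∀ c ∈ K, c ∈ S ∧ c.1 ≤ b₀.1 ∧ c.2 < x := by
    rintro c (rfl | ⟨⟨hc, hc1, hc2⟩, hcw⟩)
    · refine ⟨hb₀S, le_rfl, lt_of_le_of_ne hb₀3 fun h => hb₀C ?_⟩
      rwa [hS.snd_inj c hb₀S w hw (h.trans hw2.symm)]
    · exact ⟨hc, hc1.trans hb₀1.le, lt_of_le_of_ne hc2 fun h =>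
        hcw (hS.snd_inj c hc w hw (h.trans hw2.symm))⟩
  obtain ⟨c₀, hc₀, hmax⟩ := hKfin.exists_maximalFor Prod.snd K ⟨b₀, mem_insert _ _⟩
  have hmax' : ∀ c ∈ K, c.2 ≤ c₀.2 := fun c hc => (le_total c.2 c₀.2).elim id (hmax hc)
  have hbox : weakSouthWest S (b₀.1, c₀.2) = K := by
    ext b
    constructor
    · rintro ⟨hbS, hb1, hb2⟩
      have hbx : b.2 < x := lt_of_le_of_lt hb2 (hKx c₀ hc₀).2.2
      rcases le_or_gt b.1 t with h | h
      · refine Or.inr ⟨⟨hbS, h, hbx.le⟩, ?_⟩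
        rintro rfl
        exact hbx.ne hw2
      · exact Or.inl (hS.fst_inj b hbS b₀ hb₀S
          (le_antisymm hb1 (hmin' b ⟨hbS, h, lt_of_le_of_lt hb1 hb₀2, hbx.le⟩)))
    · exact fun hb => ⟨(hKx b hb).1, (hKx b hb).2.1, hmax' b hb⟩
  have hc : IsKCorner (p + 1) S (b₀.1, c₀.2) := by
    refine hS.isKCorner_iff.2 ⟨by rw [hbox, hKcard], ⟨c₀, (hKx c₀ hc₀).1, (hKx c₀ hc₀).2.1, rfl⟩,
      b₀, hb₀S, rfl, hmax' b₀ (mem_insert _ _)⟩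
  obtain ⟨m, hm⟩ := hno _ hc (lt_of_le_of_lt (hmono.monotone (Fin.zero_le _)) hb₀1)
    (lt_of_lt_of_le hb₀2 (hmono.monotone (Fin.le_last _)))
  have hm1 : (a m).1 = b₀.1 := by rw [hm]
  have e1 : l.castSucc < m := hmono.lt_iff_lt.1 (show (a l.castSucc).1 < (a m).1 from hm1 ▸ hb₀1)
  have e2 : m < l.succ := hmono.lt_iff_lt.1 (show (a m).1 < (a l.succ).1 from hm1 ▸ hb₀2)
  rw [Fin.lt_def] at e1 e2
  simp only [Fin.val_castSucc, Fin.val_succ] at e1 e2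
  omega

theorem exists_strictMono_enumeration {K : Set (ℝ × ℝ)} {q : ℕ} (hK : K.encard = q)
    (hinj : InjOn Prod.fst K) :
    ∃ e : Fin q → ℝ × ℝ, StrictMono (fun j => (e j).1) ∧ range e = K := by
  have hfin : K.Finite := finite_of_encard_eq_coe hK
  have hcard : (hfin.image Prod.fst).toFinset.card = q := by
    rw [← Nat.cast_inj (R := ℕ∞), ← encard_coe_eq_coe_finsetCard, Finite.coe_toFinset,
      hinj.encard_image, hK]
  let f := (hfin.image Prod.fst).toFinset.orderEmbOfFin hcard
  have hf : ∀ j, ∃ b ∈ K, b.1 = f j := fun j => by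
    have h := (Finite.mem_toFinset _).1
      (Finset.orderEmbOfFin_mem (hfin.image Prod.fst).toFinset hcard j)
    exact h
  choose e he hef using hf
  refine ⟨e, ?_, Subset.antisymm (range_subset_iff.2 he) fun b hb => ?_⟩
  · simp only [hef]
    exact f.strictMono
  · have hb' : b.1 ∈ range f := by
      rw [Finset.range_orderEmbOfFin]
      simpa using ⟨b.2, hb⟩
    obtain ⟨j, hj⟩ := hb'
    exact ⟨j, hinj (he j) hb ((hef j).trans hj)⟩

theorem IsGeneric.exists_cornerTuple_eq (hS : IsGeneric S) {a : Fin (n + 1) → ℝ × ℝ}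
    (ha : a ∈ consecutiveCorners (p + 1) n S) :
    ∃ z ∈ admissibleTuples p n ∩ voidTuples (stairsGraph p n) S, cornerTuple p n z = a := by
  classical
  have hnot := fun l b => hS.not_between ha l (b := b)
  obtain ⟨hcor, hmono, hanti, -⟩ := ha
  have hcard := fun i => (hS.isKCorner_iff.1 (hcor i)).1
  choose w hw hw1 hw2 using fun i => (hS.isKCorner_iff.1 (hcor i)).2.1
  choose d hd hd1 hd2 using fun i => (hS.isKCorner_iff.1 (hcor i)).2.2
  set C := weakSouthWest S (a 0) with hC
  have hd0 : d 0 ∈ C := ⟨hd 0, (hd1 0).le, hd2 0⟩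
  have hKcard : (C \ {d 0}).encard = p := by
    have := encard_sdiff_singleton_add_one hd0
    rw [hcard 0, Nat.cast_succ] at this
    exact WithTop.add_right_cancel ENat.one_ne_top this
  obtain ⟨e, he, heK⟩ := exists_strictMono_enumeration hKcard
    fun b hb c hc h => hS.fst_inj b hb.1.1 c hc.1.1 h
  have heC : ∀ j, e j ∈ C \ {d 0} := fun j => heK ▸ mem_range_self j
  have he0 : ∀ j, (e j).1 < (a 0).1 := fun j => lt_of_le_of_ne (heC j).1.2.1 fun h =>
    (heC j).2 (hS.fst_inj _ (heC j).1.1 _ (hd 0) (h.trans (hd1 0).symm))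
  -- First the p points of the first box other than `d 0`, by time; then the points `d i` on the
  -- right edges of the boxes.
  let z : Fin (p + n + 1) → ℝ × ℝ := fun j =>
    if h : (j : ℕ) < p then e ⟨j, h⟩ else d ⟨j - p, by omega⟩
  have hzlt : ∀ (j : Fin (p + n + 1)) (h : (j : ℕ) < p), z j = e ⟨j, h⟩ := fun j h => dif_pos h
  have hzge : ∀ (j : Fin (p + n + 1)) (h : ¬ (j : ℕ) < p), z j = d ⟨j - p, by omega⟩ :=
    fun j h => dif_neg h
  have hzd : ∀ i : Fin (n + 1), z ⟨p + i, by omega⟩ = d i := fun i => by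
    rw [hzge _ (by simp)]
    congr 1
    exact Fin.ext (by simp)
  have hzS : ∀ j, z j ∈ S := fun j => by
    by_cases h : (j : ℕ) < p
    · rw [hzlt j h]
      exact (heC _).1.1
    · rw [hzge j h]
      exact hd _
  have hzmono : StrictMono fun j => (z j).1 := by
    intro i j hij
    have hij' : (i : ℕ) < j := hij
    by_cases hi : (i : ℕ) < p <;> by_cases hj : (j : ℕ) < p
    · simp only [hzlt i hi, hzlt j hj]
      exact he hij'
    · simp only [hzlt i hi, hzge j hj, hd1]
      exact lt_of_lt_of_le (he0 _) (hmono.monotone (Fin.zero_le _))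
    · omega
    · simp only [hzge i hi, hzge j hj, hd1]
      refine hmono ?_
      rw [Fin.lt_def]
      simp only
      omega
  have hzinj : Function.Injective z := fun i j h => hzmono.injective (congrArg Prod.fst h)
  -- Such a point is in the first box, or has the time of a corner and hence is some `d i`, or lies
  -- strictly inside a strip, which `IsGeneric.not_between` excludes.
  have hrange : ∀ b ∈ S, b ∈ underStairs a → b ∈ range z := by
    rintro b hb ⟨-, -, ⟨h1, h2⟩ | ⟨l, h1, h2, h3⟩⟩
    · by_cases hbd : b = d 0
      · exact ⟨_, (hzd 0).trans hbd.symm⟩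
      · have hbe : b ∈ range e := heK ▸ ⟨⟨hb, h1, h2⟩, hbd⟩
        obtain ⟨j, rfl⟩ := hbe
        exact ⟨⟨j, by omega⟩, hzlt _ j.2⟩
    · rcases h1.lt_or_eq with h1 | h1
      · rcases h2.lt_or_eq with h2 | h2
        · exact absurd h3 (not_le.2 (hnot l b hb h1 h2))
        · exact ⟨_, (hzd l.succ).trans (hS.fst_inj _ (hd _) b hb ((hd1 _).trans h2.symm))⟩
      · exact ⟨_, (hzd l.castSucc).trans (hS.fst_inj _ (hd _) b hb ((hd1 _).trans h1))⟩
  have hbox : ∀ i : Fin (n + 1), weakSouthWest S (a i) =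
      z '' {j | (j : ℕ) ≤ p + i ∧ (z j).2 ≤ (a i).2} := by
    intro i
    have hti : (z ⟨p + i, by omega⟩).1 = (a i).1 := by rw [hzd, hd1]
    ext b
    constructor
    · rintro ⟨h1, h2, h3⟩
      obtain ⟨j, rfl⟩ := hrange b h1 (mem_underStairs hanti.antitone (hS.pos b h1) h2 h3)
      refine ⟨j, ⟨?_, h3⟩, rfl⟩
      rw [← hti] at h2
      exact hzmono.le_iff_le.1 h2
    · rintro ⟨j, ⟨h1, h2⟩, rfl⟩
      refine ⟨hzS j, ?_, h2⟩
      rw [← hti]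
      exact hzmono.monotone (show j ≤ (⟨p + i, by omega⟩ : Fin (p + n + 1)) from h1)
  have hcount : ∀ i : Fin (n + 1), (Finset.univ.filter fun j : Fin (p + n + 1) =>
      (j : ℕ) ≤ p + i ∧ (z j).2 ≤ (a i).2).card = p + 1 := fun i => by
    have := hcard i
    rw [hbox, encard_image_filter hzinj] at this
    exact_mod_cast this
  have hlevel : ∀ i : Fin (n + 1), level p n (fun j => (z j).2) i = (a i).2 := by
    intro i
    refine le_antisymm (level_le_iff.2 (hcount i).ge) ?_
    -- A smaller level would put p + 1 entries strictly below the corner, in addition to `w i` at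
    -- its height, but the box has only p + 1 points.
    by_contra! hlt
    have hle := level_lt_iff.1 hlt
    have hwi : w i ∈ weakSouthWest S (a i) := ⟨hw i, hw1 i, (hw2 i).le⟩
    rw [hbox] at hwi
    obtain ⟨j, ⟨hj1, hj2⟩, hj⟩ := hwi
    refine absurd hle (not_le.2 (lt_of_lt_of_eq (Finset.card_lt_card ?_) (hcount i)))
    rw [Finset.ssubset_iff_of_subset]
    · refine ⟨j, Finset.mem_filter.2 ⟨Finset.mem_univ _, hj1, hj2⟩, fun h => ?_⟩
      have := (Finset.mem_filter.1 h).2.2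
      rw [hj, hw2] at this
      exact lt_irrefl _ this
    · intro j' hj'
      obtain ⟨h1, h2⟩ := (Finset.mem_filter.1 hj').2
      exact Finset.mem_filter.2 ⟨Finset.mem_univ _, h1, h2.le⟩
  have hza : cornerTuple p n z = a := by
    funext i
    refine Prod.ext ?_ (hlevel i)
    simp only [cornerTuple, hzd, hd1]
  refine ⟨z, ⟨⟨⟨hzmono, (hS.pos _ (hzS 0)).1⟩, fun j => (hS.pos _ (hzS j)).2, fun j l hj => ?_⟩,
    hzS, hzinj, ?_⟩, hza⟩
  · have hl : l < n := by omega
    have e1 : z j = d ⟨l + 1, by omega⟩ := by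
      rw [← hzd]
      exact congrArg z (Fin.ext hj)
    have e2 : level p n (fun j => (z j).2) l = (a ⟨l, by omega⟩).2 := hlevel ⟨l, by omega⟩
    rw [e2]
    simp only [e1]
    refine (hd2 _).trans_lt (hanti ?_)
    rw [Fin.lt_def]
    exact Nat.lt_succ_self l
  · rintro b ⟨hb, hb'⟩
    refine hrange b hb ?_
    rw [← hza]
    exact hb'

theorem IsGeneric.image_cornerTuple (hS : IsGeneric S) :
    cornerTuple p n '' (admissibleTuples p n ∩ voidTuples (stairsGraph p n) S) =
      consecutiveCorners (p + 1) n S := by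
  refine Subset.antisymm ?_ fun a ha => hS.exists_cornerTuple_eq ha
  rintro _ ⟨z, ⟨hA, hz⟩, rfl⟩
  exact hS.cornerTuple_mem hA hz

theorem IsGeneric.encard_consecutiveCorners_inter (hS : IsGeneric S)
    (B : Set (Fin (n + 1) → ℝ × ℝ)) :
    (consecutiveCorners (p + 1) n S ∩ B).encard =
      (admissibleTuples p n ∩ cornerTuple p n ⁻¹' B ∩
        voidTuples (stairsGraph p n) S).encard := by
  have h : consecutiveCorners (p + 1) n S ∩ B = cornerTuple p n ''
      (admissibleTuples p n ∩ cornerTuple p n ⁻¹' B ∩ voidTuples (stairsGraph p n) S) := by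
    rw [← hS.image_cornerTuple, inter_right_comm, image_inter_preimage]
  rw [h, (hS.injOn_cornerTuple.mono ?_).encard_image]
  rw [inter_right_comm]
  exact inter_subset_left

end Bijection

/-! ### Almost sure genericity and the area below the staircase. -/

section Assembly

variable {p n : ℕ}

theorem lintegral_arrow_prod {N : ℕ} {F : (Fin N → ℝ × ℝ) → ℝ≥0∞} (hF : Measurable F) :
    ∫⁻ z, F z = ∫⁻ s : Fin N → ℝ, ∫⁻ y : Fin N → ℝ, F fun j => (s j, y j) := by
  have h := ((volume_measurePreserving_arrowProdEquivProdArrow ℝ ℝ (Fin N)).symm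
    (MeasurableEquiv.arrowProdEquivProdArrow ℝ ℝ (Fin N))).lintegral_comp hF
  rw [← h, Measure.volume_eq_prod, lintegral_prod _ (by fun_prop)]
  rfl

theorem ae_injective_fst (N : ℕ) :
    ∀ᵐ z : Fin N → ℝ × ℝ, Function.Injective fun j => (z j).1 :=
  ((volume_measurePreserving_arrowProdEquivProdArrow ℝ ℝ (Fin N)).quasiMeasurePreserving.ae
    (Measure.quasiMeasurePreserving_fst.ae (ae_injective_pi N)))

theorem ae_injective_snd (N : ℕ) :
    ∀ᵐ z : Fin N → ℝ × ℝ, Function.Injective fun j => (z j).2 :=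
  ((volume_measurePreserving_arrowProdEquivProdArrow ℝ ℝ (Fin N)).quasiMeasurePreserving.ae
    (Measure.quasiMeasurePreserving_snd.ae (ae_injective_pi N)))

theorem volume_fst_eq (c : ℝ) : volume {b : ℝ × ℝ | b.1 = c} = 0 := by
  have : {b : ℝ × ℝ | b.1 = c} = {c} ×ˢ univ := by
    ext b
    simp
  rw [this, Measure.volume_eq_prod, Measure.prod_prod]
  simp

theorem volume_snd_eq (c : ℝ) : volume {b : ℝ × ℝ | b.2 = c} = 0 := by
  have : {b : ℝ × ℝ | b.2 = c} = univ ×ˢ {c} := by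
    ext b
    simp
  rw [this, Measure.volume_eq_prod, Measure.prod_prod]
  simp

theorem volume_quadrant_sdiff : volume (quadrant \ {b | 0 < b.1 ∧ 0 < b.2}) = 0 := by
  refine measure_mono_null (fun b hb => ?_)
    (measure_union_null (volume_fst_eq 0) (volume_snd_eq 0))
  by_contra h
  simp only [mem_union, mem_ofPred_eq, not_or] at h
  exact hb.2 ⟨lt_of_le_of_ne hb.1.1 (Ne.symm h.1), lt_of_le_of_ne hb.1.2 (Ne.symm h.2)⟩

theorem continuous_cornerTuple (p n : ℕ) : Continuous (cornerTuple p n) := by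
  refine continuous_pi fun i => Continuous.prodMk (by fun_prop) ?_
  exact (continuous_level (i : ℕ)).comp (by fun_prop)

theorem isClosed_stairsGraph (p n : ℕ) : IsClosed (stairsGraph p n) := by
  have hc : ∀ i, Continuous fun w : (Fin (p + n + 1) → ℝ × ℝ) × (ℝ × ℝ) =>
      cornerTuple p n w.1 i := fun i =>
    (continuous_apply i).comp ((continuous_cornerTuple p n).comp continuous_fst)
  have heq : stairsGraph p n = {w | 0 ≤ w.2.1} ∩ ({w | 0 ≤ w.2.2} ∩
      (({w | w.2.1 ≤ (cornerTuple p n w.1 0).1} ∩ {w | w.2.2 ≤ (cornerTuple p n w.1 0).2}) ∪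
        ⋃ l : Fin n, {w | (cornerTuple p n w.1 l.castSucc).1 ≤ w.2.1} ∩
          ({w | w.2.1 ≤ (cornerTuple p n w.1 l.succ).1} ∩
            {w | w.2.2 ≤ (cornerTuple p n w.1 l.castSucc).2}))) := by
    ext w
    simp only [stairsGraph, underStairs, mem_iUnion, mem_inter_iff, mem_union, mem_ofPred_eq]
  rw [heq]
  refine (isClosed_le (by fun_prop) (by fun_prop)).inter ((isClosed_le (by fun_prop)
    (by fun_prop)).inter (((isClosed_le (by fun_prop) (hc 0).fst).inter
    (isClosed_le (by fun_prop) (hc 0).snd)).union (isClosed_iUnion_of_finite fun l => ?_)))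
  exact (isClosed_le (hc _).fst (by fun_prop)).inter ((isClosed_le (by fun_prop) (hc _).fst).inter
    (isClosed_le (by fun_prop) (hc _).snd))

theorem stairsGraph_bounded (M : ℕ) (z : Fin (p + n + 1) → ℝ × ℝ)
    (hz : ∀ i, z i ∈ Icc 0 (M : ℝ) ×ˢ Icc 0 (M : ℝ)) (b : ℝ × ℝ)
    (hb : (z, b) ∈ stairsGraph p n) : b ∈ Icc 0 (M : ℝ) ×ˢ Icc 0 (M : ℝ) := by
  have h1 : ∀ i, (cornerTuple p n z i).1 ≤ M := fun i => (hz _).1.2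
  have h2 : ∀ i, (cornerTuple p n z i).2 ≤ M := fun i => by
    obtain ⟨j, -, hj⟩ := exists_eq_level (fun j => (z j).2) (i : ℕ)
    exact hj.symm.le.trans (hz j).2.2
  obtain ⟨hb1, hb2, ⟨h3, h4⟩ | ⟨l, -, h3, h4⟩⟩ := hb
  · exact ⟨⟨hb1, h3.trans (h1 _)⟩, hb2, h4.trans (h2 _)⟩
  · exact ⟨⟨hb1, h3.trans (h1 _)⟩, hb2, h4.trans (h2 _)⟩

/-- The area below the staircase. -/
theorem volume_underStairs {a : Fin (n + 1) → ℝ × ℝ} (hmono : StrictMono fun i => (a i).1)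
    (h0 : 0 < (a 0).1) (hx : ∀ i, 0 < (a i).2) :
    volume (underStairs a) = ENNReal.ofReal ((a 0).2 * (a 0).1 +
      ∑ i : Fin n, ((a i.succ).1 - (a i.castSucc).1) * (a i.castSucc).2) := by
  -- Rectangle 0 is the box of the first corner and rectangle `l.succ` the strip after corner `l`,
  -- so the first height occurs twice. Rectangles overlap only in vertical lines.
  let lo : Fin (n + 1) → ℝ := Fin.cons 0 fun l => (a l.castSucc).1
  let h : Fin (n + 1) → ℝ := Fin.cons (a 0).2 fun l => (a l.castSucc).2
  let R : Fin (n + 1) → Set (ℝ × ℝ) := fun i => Icc (lo i) (a i).1 ×ˢ Icc 0 (h i)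
  have hpos : ∀ i, 0 < (a i).1 := fun i => h0.trans_le (hmono.monotone (Fin.zero_le i))
  have hU : underStairs a = ⋃ i, R i := by
    ext b
    simp only [mem_iUnion, Fin.exists_fin_succ, R, lo, h, Fin.cons_zero, Fin.cons_succ,
      mem_prod, mem_Icc]
    constructor
    · rintro ⟨h1, h2, ⟨h3, h4⟩ | ⟨l, h3, h4, h5⟩⟩
      · exact Or.inl ⟨⟨h1, h3⟩, h2, h4⟩
      · exact Or.inr ⟨l, ⟨h3, h4⟩, h2, h5⟩
    · rintro (⟨⟨h1, h3⟩, h2, h4⟩ | ⟨l, ⟨h3, h4⟩, h2, h5⟩)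
      · exact ⟨h1, h2, Or.inl ⟨h3, h4⟩⟩
      · exact ⟨(hpos _).le.trans h3, h2, Or.inr ⟨l, h3, h4, h5⟩⟩
  have hlo : ∀ i j, i < j → (a i).1 ≤ lo j := by
    intro i j
    refine Fin.cases ?_ (fun l => ?_) j
    · exact fun hi => absurd hi (Fin.not_lt_zero i)
    · exact fun hi => hmono.monotone (Fin.le_castSucc_iff.2 hi)
  have hdisj : ∀ i j, i < j → AEDisjoint volume (R i) (R j) := fun i j hij =>
    measure_mono_null (fun b hb => le_antisymm hb.1.1.2 ((hlo i j hij).trans hb.2.1.1))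
      (volume_fst_eq (a i).1)
  have hpair : Pairwise (Function.onFun (AEDisjoint volume) R) := fun i j hij =>
    (lt_or_gt_of_ne hij).elim (hdisj i j) fun h => (hdisj j i h).symm
  have hvol : ∀ i, volume (R i) = ENNReal.ofReal (((a i).1 - lo i) * h i) := fun i => by
    have hle : 0 ≤ (a i).1 - lo i := by
      refine Fin.cases ?_ (fun l => ?_) i
      · simpa [lo] using h0.le
      · simpa [lo] using (hmono l.castSucc_lt_succ).le
    rw [Measure.volume_eq_prod, Measure.prod_prod, Real.volume_Icc, Real.volume_Icc, sub_zero,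
      ENNReal.ofReal_mul hle]
  have hterm : ∀ i, 0 ≤ ((a i).1 - lo i) * h i := by
    refine Fin.cases ?_ fun l => ?_
    · simpa [lo, h] using mul_nonneg h0.le (hx 0).le
    · have := (hmono l.castSucc_lt_succ).le
      simp only [lo, h, Fin.cons_succ]
      exact mul_nonneg (sub_nonneg.2 this) (hx _).le
  rw [hU, measure_iUnion₀ hpair fun i =>
    (measurableSet_Icc.prod measurableSet_Icc).nullMeasurableSet, tsum_fintype]
  simp only [hvol]
  rw [← ENNReal.ofReal_sum_of_nonneg fun i _ => hterm i, Fin.sum_univ_succ]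
  simp only [lo, h, Fin.cons_zero, Fin.cons_succ, sub_zero, mul_comm (a 0).1]

/-- The probability that the region below the staircase is empty. -/
noncomputable def stairsWeight (n : ℕ) (a : Fin (n + 1) → ℝ × ℝ) : ℝ≥0∞ :=
  ENNReal.ofReal (Real.exp (-((a 0).2 * (a 0).1) -
    ∑ i : Fin n, ((a i.succ).1 - (a i.castSucc).1) * (a i.castSucc).2))

theorem expNeg_volume_underStairs {a : Fin (n + 1) → ℝ × ℝ} (hmono : StrictMono fun i => (a i).1)
    (h0 : 0 < (a 0).1) (hx : ∀ i, 0 < (a i).2) :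
    expNeg (volume (underStairs a)) = stairsWeight n a := by
  have hnn : 0 ≤ (a 0).2 * (a 0).1 +
      ∑ i : Fin n, ((a i.succ).1 - (a i.castSucc).1) * (a i.castSucc).2 :=
    add_nonneg (mul_nonneg (hx 0).le h0.le) (Finset.sum_nonneg fun l _ =>
      mul_nonneg (sub_nonneg.2 (hmono l.castSucc_lt_succ).le) (hx _).le)
  rw [volume_underStairs hmono h0 hx, expNeg, ENNReal.toReal_ofReal hnn, stairsWeight, neg_add,
    sub_eq_add_neg]

variable {Ω : Type*} [MeasurableSpace Ω] {P : Ω → Set (ℝ × ℝ)} {μ : Measure Ω}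

/-- The Mecke formula with an empty region shows that the expected number of pairs of distinct
points in a null set is zero. -/
theorem IsPoissonPointProcess.ae_pair_notMem
    (hP : IsPoissonPointProcess P ((volume : Measure (ℝ × ℝ)).restrict quadrant) μ)
    {A : Set (Fin 2 → ℝ × ℝ)} (hA : MeasurableSet A) (hA0 : volume A = 0) :
    ∀ᵐ ω ∂μ, ∀ a ∈ P ω, ∀ b ∈ P ω, ![a, b] ∈ A → a = b := by
  obtain ⟨hm, h⟩ := hP.lintegral_inter_voidTuples (G := ∅) isClosed_empty (by simp) hA
  rw [Measure.restrict_eq_zero.2 (measure_mono_null (fun z hz => hz.1.1) hA0),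
    lintegral_zero_measure, lintegral_eq_zero_iff' hm] at h
  filter_upwards [h] with ω hω a ha b hb hab
  by_contra hne
  simp only [Pi.zero_apply, ENat.toENNReal_eq_zero, encard_eq_zero] at hω
  refine absurd (show ![a, b] ∈ A ∩ voidTuples ∅ (P ω) from ⟨hab, ?_, ?_, ?_⟩) (by simp [hω])
  · intro i
    fin_cases i
    · exact ha
    · exact hb
  · intro i j hij
    fin_cases i <;> fin_cases j <;> simp_all [eq_comm]
  · simp

theorem IsPoissonPointProcess.ae_isGeneric
    (hP : IsPoissonPointProcess P ((volume : Measure (ℝ × ℝ)).restrict quadrant) μ) :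
    ∀ᵐ ω ∂μ, IsGeneric (P ω) := by
  have hopen : MeasurableSet {b : ℝ × ℝ | 0 < b.1 ∧ 0 < b.2} :=
    (measurableSet_lt measurable_const measurable_fst).inter
      (measurableSet_lt measurable_const measurable_snd)
  have hpos := hP.ae_inter_eq_empty hopen.compl (by
    rw [Measure.restrict_apply hopen.compl, inter_comm, ← Set.sdiff_eq]
    exact volume_quadrant_sdiff)
  have hfin : ∀ᵐ ω ∂μ, ∀ M : ℕ, (P ω ∩ Icc 0 (M : ℝ) ×ˢ Icc 0 (M : ℝ)).Finite := by
    refine ae_all_iff.2 fun M => hP.ae_finite_inter (measurableSet_Icc.prod measurableSet_Icc) ?_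
    exact ((Measure.restrict_apply_le _ _).trans_lt
      (isCompact_Icc.prod isCompact_Icc).measure_lt_top).ne
  have hfst := hP.ae_pair_notMem (A := {z | (z 0).1 = (z 1).1})
    (measurableSet_eq_fun (by fun_prop) (by fun_prop))
    (by
      refine measure_mono_null ?_ (ae_iff.1 (ae_injective_fst 2))
      exact fun z hz hinj => absurd (hinj hz) (by simp))
  have hsnd := hP.ae_pair_notMem (A := {z | (z 0).2 = (z 1).2})
    (measurableSet_eq_fun (by fun_prop) (by fun_prop))
    (by
      refine measure_mono_null ?_ (ae_iff.1 (ae_injective_snd 2))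
      exact fun z hz hinj => absurd (hinj hz) (by simp))
  filter_upwards [hpos, hfin, hfst, hsnd] with ω h1 h2 h3 h4
  have hposω : ∀ a ∈ P ω, 0 < a.1 ∧ 0 < a.2 := fun a ha => by
    by_contra h
    exact absurd (show a ∈ P ω ∩ {b : ℝ × ℝ | 0 < b.1 ∧ 0 < b.2}ᶜ from ⟨ha, h⟩) (by simp [h1])
  refine ⟨hposω, fun a ha b hb hab => h3 a ha b hb (by simpa using hab),
    fun a ha b hb hab => h4 a ha b hb (by simpa using hab), fun a => ?_⟩
  obtain ⟨M, hM⟩ := exists_nat_ge (max a.1 a.2)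
  refine (h2 M).subset fun b hb => ⟨hb.1, ⟨(hposω b hb.1).1.le, ?_⟩, (hposω b hb.1).2.le, ?_⟩
  · exact hb.2.1.trans ((le_max_left _ _).trans hM)
  · exact hb.2.2.trans ((le_max_right _ _).trans hM)

end Assembly

/-! ### Change of variables, symmetry and the intensity. -/

section Main

variable {p n : ℕ}

theorem measurableSet_admissibleTuples (p n : ℕ) : MeasurableSet (admissibleTuples p n) := by
  have h1 : Measurable fun (z : Fin (p + n + 1) → ℝ × ℝ) j => (z j).1 := by fun_prop
  have h2 : Measurable fun (z : Fin (p + n + 1) → ℝ × ℝ) j => (z j).2 := by fun_prop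
  exact (h1 (measurableSet_increasingTimes _)).inter (h2 (measurableSet_admissibleHeights p n))

theorem admissibleTuples_subset (p n : ℕ) : admissibleTuples p n ⊆
    {z | Function.Injective z} ∩ Set.pi univ fun _ => quadrant := by
  rintro z ⟨⟨h1, h2⟩, h3, -⟩
  exact ⟨fun i j h => h1.injective (congrArg Prod.fst h),
    fun j _ => ⟨h2.le.trans (h1.monotone (Fin.zero_le j)), (h3 j).le⟩⟩

theorem measurable_stairsWeight (n : ℕ) : Measurable (stairsWeight n) := by
  unfold stairsWeight
  fun_prop

theorem measurableSet_decreasingTuples (n : ℕ) : MeasurableSet (decreasingTuples n) := by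
  have h1 : Measurable fun (z : Fin (n + 1) → ℝ × ℝ) j => (z j).1 := by fun_prop
  have h2 : Measurable fun (z : Fin (n + 1) → ℝ × ℝ) j => (z j).2 := by fun_prop
  have h3 : MeasurableSet {z : Fin (n + 1) → ℝ × ℝ | 0 < (z 0).1} :=
    measurableSet_lt measurable_const (by fun_prop)
  have h4 : MeasurableSet {z : Fin (n + 1) → ℝ × ℝ | 0 < (z (Fin.last n)).2} :=
    measurableSet_lt measurable_const (by fun_prop)
  exact (h1 measurableSet_strictMono).inter ((h2 measurableSet_strictAnti).inter (h3.inter h4))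

theorem expNeg_volume_stairsGraph {z : Fin (p + n + 1) → ℝ × ℝ} (hz : z ∈ admissibleTuples p n) :
    expNeg (volume {b | (z, b) ∈ stairsGraph p n}) = stairsWeight n (cornerTuple p n z) := by
  change expNeg (volume (underStairs (cornerTuple p n z))) = _
  refine expNeg_volume_underStairs (strictMono_cornerTuple hz) ?_ fun i => ?_
  · exact hz.1.2.trans_le (hz.1.1.monotone (Fin.zero_le _))
  · obtain ⟨j, -, hj⟩ := exists_eq_level (fun j => (z j).2) (i : ℕ)
    exact (hz.2.1 j).trans_le hj.le

theorem ofReal_cornerDensity {a : Fin (n + 1) → ℝ × ℝ} (ha : a ∈ decreasingTuples n) :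
    ENNReal.ofReal (cornerDensity (p + 1) n a) =
      ENNReal.ofReal ((a 0).1 ^ p / p.factorial) * (((p + 1 : ℕ) : ℝ≥0∞) ^ (n + 1) *
        ENNReal.ofReal ((a (Fin.last n)).2 ^ p) * stairsWeight n a) := by
  obtain ⟨-, -, h0, hn⟩ := ha
  rw [stairsWeight, ← ENNReal.ofReal_natCast, ← ENNReal.ofReal_pow (by positivity),
    ← ENNReal.ofReal_mul (by positivity), ← ENNReal.ofReal_mul (by positivity),
    ← ENNReal.ofReal_mul (by positivity)]
  congr 1
  rw [cornerDensity, Nat.cast_succ, Real.Gamma_nat_eq_factorial, Nat.add_sub_cancel, mul_pow]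
  ring

/-- The change of variables from the points to the corners. -/
theorem lintegral_cornerTuple {B : Set (Fin (n + 1) → ℝ × ℝ)} (hB : MeasurableSet B) :
    ∫⁻ z in admissibleTuples p n ∩ cornerTuple p n ⁻¹' B, stairsWeight n (cornerTuple p n z) =
      ∫⁻ a in decreasingTuples n ∩ B, ENNReal.ofReal (cornerDensity (p + 1) n a) := by
  let H : (Fin (n + 1) → ℝ × ℝ) → ℝ≥0∞ := B.indicator (stairsWeight n)
  have hH : Measurable H := (measurable_stairsWeight n).indicator hB
  have hzip : Measurable fun w : (Fin (n + 1) → ℝ) × (Fin (n + 1) → ℝ) =>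
      fun j => (w.1 j, w.2 j) := by fun_prop
  have hzipt : ∀ t : Fin (n + 1) → ℝ, Measurable fun x : Fin (n + 1) → ℝ =>
      H fun j => (t j, x j) := fun t => hH.comp (hzip.comp measurable_prodMk_left)
  have hc : Measurable (cornerTuple p n) := (continuous_cornerTuple p n).measurable
  let D : (Fin (n + 1) → ℝ) → ℝ≥0∞ := fun x =>
    ((p + 1 : ℕ) : ℝ≥0∞) ^ (n + 1) * ENNReal.ofReal (x (Fin.last n) ^ p)
  have hD : Measurable D := by fun_prop
  -- The weight left after integrating the heights; it involves only the last n + 1 times, which are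
  -- the corner times, so `lintegral_increasingTimes` applies to it.
  let g : (Fin (n + 1) → ℝ) → ℝ≥0∞ := fun t =>
    ∫⁻ x in decreasingHeights n, D x * H fun j => (t j, x j)
  have hg : Measurable g := by
    refine Measurable.lintegral_prod_right' (f := fun w : (Fin (n + 1) → ℝ) × (Fin (n + 1) → ℝ) =>
      D w.2 * H fun j => (w.1 j, w.2 j)) ?_
    exact (hD.comp measurable_snd).mul (hH.comp hzip)
  have hleft : ∫⁻ z in admissibleTuples p n ∩ cornerTuple p n ⁻¹' B,
      stairsWeight n (cornerTuple p n z) =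
      ∫⁻ t in increasingTimes n, ENNReal.ofReal (t 0 ^ p / p.factorial) * g t := by
    rw [inter_comm, ← setLIntegral_indicator (hc hB),
      ← lintegral_indicator (measurableSet_admissibleTuples p n), lintegral_arrow_prod,
      ← lintegral_increasingTimes n p hg, ← lintegral_indicator (measurableSet_increasingTimes _)]
    · refine lintegral_congr fun s => ?_
      by_cases hs : s ∈ increasingTimes (p + n)
      · rw [indicator_of_mem hs]
        simp only [g, D]
        rw [← lintegral_admissibleHeights p n (hzipt _),
          ← lintegral_indicator (measurableSet_admissibleHeights p n)]
        refine lintegral_congr fun y => ?_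
        by_cases hy : y ∈ admissibleHeights p n
        · rw [indicator_of_mem hy, indicator_of_mem (show (fun j => (s j, y j)) ∈
            admissibleTuples p n from ⟨hs, hy⟩)]
          rfl
        · rw [indicator_of_notMem hy, indicator_of_notMem fun h => hy h.2]
      · rw [indicator_of_notMem hs, ← lintegral_zero]
        refine lintegral_congr fun y => ?_
        rw [indicator_of_notMem fun h => hs h.1]
    · exact ((((measurable_stairsWeight n).comp hc).indicator (hc hB)).indicator
        (measurableSet_admissibleTuples p n))
  rw [hleft, inter_comm, ← setLIntegral_indicator hB,
    ← lintegral_indicator (measurableSet_decreasingTuples n)]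
  have hcongr : ∀ a : Fin (n + 1) → ℝ × ℝ, (decreasingTuples n).indicator
      (fun a => B.indicator (fun a => ENNReal.ofReal (cornerDensity (p + 1) n a)) a) a =
      (decreasingTuples n).indicator (fun a => ENNReal.ofReal ((a 0).1 ^ p / p.factorial) *
        (D (fun j => (a j).2) * H a)) a := by
    intro a
    by_cases ha : a ∈ decreasingTuples n
    · rw [indicator_of_mem ha, indicator_of_mem ha]
      by_cases haB : a ∈ B
      · rw [indicator_of_mem haB, ofReal_cornerDensity ha]
        simp only [H, indicator_of_mem haB, D]
      · simp only [H, indicator_of_notMem haB, mul_zero]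
    · rw [indicator_of_notMem ha, indicator_of_notMem ha]
  rw [lintegral_congr hcongr, lintegral_arrow_prod,
    ← lintegral_indicator (measurableSet_increasingTimes n)]
  · refine lintegral_congr fun t => ?_
    by_cases ht : t ∈ increasingTimes n
    · rw [indicator_of_mem ht, ← lintegral_const_mul' _ _ ENNReal.ofReal_ne_top,
        ← lintegral_indicator (measurableSet_decreasingHeights n)]
      refine lintegral_congr fun x => ?_
      by_cases hx : x ∈ decreasingHeights n
      · rw [indicator_of_mem hx, indicator_of_mem (show (fun j => (t j, x j)) ∈
          decreasingTuples n from ⟨ht.1, hx.1, ht.2, hx.2⟩)]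
      · rw [indicator_of_notMem hx, indicator_of_notMem fun h => hx ⟨h.2.1, h.2.2.2⟩]
    · rw [indicator_of_notMem ht, ← lintegral_zero]
      refine lintegral_congr fun x => ?_
      rw [indicator_of_notMem fun h => ht ⟨h.1, h.2.2.1⟩]
  · have h1 : Measurable fun a : Fin (n + 1) → ℝ × ℝ =>
        ENNReal.ofReal ((a 0).1 ^ p / p.factorial) := by fun_prop
    have h2 : Measurable fun (a : Fin (n + 1) → ℝ × ℝ) j => (a j).2 := by fun_prop
    exact (h1.mul ((hD.comp h2).mul hH)).indicator (measurableSet_decreasingTuples n)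

/-- The embedding of `ℕ∞` into `ℝ≥0∞` has a measurable left inverse `r`. -/
theorem aemeasurable_of_toENNReal {Ω : Type*} [MeasurableSpace Ω] {μ : Measure Ω} {f : Ω → ℕ∞}
    (hf : AEMeasurable (fun ω => (f ω : ℝ≥0∞)) μ) : AEMeasurable f μ := by
  classical
  let r : ℝ≥0∞ → ℕ∞ := fun x => if x = ∞ then ⊤ else (⌊x.toReal⌋₊ : ℕ∞)
  have hr : Measurable r := by
    refine Measurable.ite (measurableSet_singleton _) measurable_const ?_
    exact (Measurable.of_discrete (f := fun j : ℕ => (j : ℕ∞))).comp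
      (Nat.measurable_floor.comp ENNReal.measurable_toReal)
  have hrf : f = fun ω => r (f ω : ℝ≥0∞) := by
    funext ω
    cases f ω using ENat.recTopCoe with
    | top => simp [r]
    | coe j => simp [r]
  rw [hrf]
  exact hr.comp_aemeasurable hf

theorem IsPoissonPointProcess.lintegral_consecutiveCorners {Ω : Type*} [MeasurableSpace Ω]
    {μ : Measure Ω} {P : Ω → Set (ℝ × ℝ)}
    (hP : IsPoissonPointProcess P ((volume : Measure (ℝ × ℝ)).restrict quadrant) μ) (p n : ℕ)
    {B : Set (Fin (n + 1) → ℝ × ℝ)} (hB : MeasurableSet B) :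
    AEMeasurable (fun ω => (consecutiveCorners (p + 1) n (P ω) ∩ B).encard) μ ∧
    ∫⁻ ω, ((consecutiveCorners (p + 1) n (P ω) ∩ B).encard : ℝ≥0∞) ∂μ =
      ∫⁻ a in decreasingTuples n ∩ B, ENNReal.ofReal (cornerDensity (p + 1) n a) := by
  have hA : MeasurableSet (admissibleTuples p n ∩ cornerTuple p n ⁻¹' B) :=
    (measurableSet_admissibleTuples p n).inter ((continuous_cornerTuple p n).measurable hB)
  obtain ⟨hm, hval⟩ := hP.lintegral_inter_voidTuples (isClosed_stairsGraph p n)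
    stairsGraph_bounded hA
  have hae : (fun ω => ((admissibleTuples p n ∩ cornerTuple p n ⁻¹' B ∩
      voidTuples (stairsGraph p n) (P ω)).encard : ℝ≥0∞)) =ᵐ[μ]
      fun ω => ((consecutiveCorners (p + 1) n (P ω) ∩ B).encard : ℝ≥0∞) := by
    filter_upwards [hP.ae_isGeneric] with ω hω
    rw [hω.encard_consecutiveCorners_inter]
  refine ⟨aemeasurable_of_toENNReal (hm.congr hae), ?_⟩
  rw [← lintegral_congr_ae hae, hval, inter_assoc, inter_eq_self_of_subset_left
    (inter_subset_left.trans (admissibleTuples_subset p n)), ← lintegral_cornerTuple hB]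
  exact setLIntegral_congr_fun hA fun z hz => expNeg_volume_stairsGraph hz.1

/-- The substitution exchanges vertical and horizontal slices of the staircase. The two sums differ
by the telescoping sum of the products xᵢ tᵢ, which the change of the leading term compensates. -/
theorem cornerDensity_swapTuple (k n : ℕ) (a : Fin (n + 1) → ℝ × ℝ) :
    cornerDensity k n (swapTuple a) = cornerDensity k n a := by
  have hsum : ∑ i : Fin n, ((swapTuple a i.succ).1 - (swapTuple a i.castSucc).1) *
      (swapTuple a i.castSucc).2 =
      ∑ i : Fin n, ((a i.castSucc).2 - (a i.succ).2) * (a i.succ).1 := by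
    rw [← Equiv.sum_comp Fin.revPerm]
    refine Finset.sum_congr rfl fun i _ => ?_
    simp only [swapTuple, Fin.revPerm_apply, Fin.rev_succ, Fin.rev_castSucc, Fin.rev_rev]
  have htel : ∑ i : Fin n, ((a i.succ).2 * (a i.succ).1 - (a i.castSucc).2 * (a i.castSucc).1) =
      (a (Fin.last n)).2 * (a (Fin.last n)).1 - (a 0).2 * (a 0).1 := by
    have h1 := Fin.sum_univ_succ fun i => (a i).2 * (a i).1
    have h2 := Fin.sum_univ_castSucc fun i => (a i).2 * (a i).1
    rw [Finset.sum_sub_distrib]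
    linarith
  have hexp : ∑ i : Fin n, ((a i.castSucc).2 - (a i.succ).2) * (a i.succ).1 =
      ∑ i : Fin n, ((a i.succ).1 - (a i.castSucc).1) * (a i.castSucc).2 -
      ((a (Fin.last n)).2 * (a (Fin.last n)).1 - (a 0).2 * (a 0).1) := by
    rw [← htel, ← Finset.sum_sub_distrib]
    exact Finset.sum_congr rfl fun i _ => by ring
  rw [cornerDensity, hsum, hexp, cornerDensity]
  have h0 : swapTuple a 0 = ((a (Fin.last n)).2, (a (Fin.last n)).1) := by simp [swapTuple]
  have hl : swapTuple a (Fin.last n) = ((a 0).2, (a 0).1) := by simp [swapTuple]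
  rw [h0, hl]
  simp only
  rw [mul_comm (a (Fin.last n)).2 (a 0).1]
  congr 2
  ring

theorem cornerDensity_const (k : ℕ) (t x : ℝ) : cornerDensity k 0 (fun _ => (t, x)) =
    k / Real.Gamma k * (t * x) ^ (k - 1) * Real.exp (-(t * x)) := by
  simp [cornerDensity, mul_comm x t]

/-- For a single corner the monotonicity and no-gap conditions are vacuous. -/
theorem encard_corners_inter (k : ℕ) (S A : Set (ℝ × ℝ)) :
    (corners k S ∩ A).encard = (consecutiveCorners k 0 S ∩ {a | a 0 ∈ A}).encard := by
  have hinj : Function.Injective fun (b : ℝ × ℝ) (_ : Fin (0 + 1)) => b :=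
    fun b c h => congrFun h 0
  rw [← hinj.encard_image]
  congr 1
  ext a
  have h0 : ∀ i : Fin (0 + 1), i = 0 := fun i => Fin.ext (by omega)
  constructor
  · rintro ⟨b, ⟨hb, hbA⟩, rfl⟩
    refine ⟨⟨fun _ => hb, fun i j hij => ?_, fun i j hij => ?_, fun c _ h1 h2 => ?_⟩, hbA⟩
    · rw [h0 i, h0 j] at hij
      exact absurd hij (lt_irrefl _)
    · rw [h0 i, h0 j] at hij
      exact absurd hij (lt_irrefl _)
    · exact absurd h1 (lt_asymm h2)
  · rintro ⟨h, hA⟩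
    exact ⟨a 0, ⟨h.1 0, hA⟩, funext fun i => by rw [h0 i]⟩

theorem lintegral_decreasingTuples_zero (k : ℕ) (A : Set (ℝ × ℝ)) :
    ∫⁻ a in decreasingTuples 0 ∩ {a | a 0 ∈ A}, ENNReal.ofReal (cornerDensity k 0 a) =
      ∫⁻ a in quadrant ∩ A, ENNReal.ofReal
        (k / Real.Gamma k * (a.1 * a.2) ^ (k - 1) * Real.exp (-(a.1 * a.2))) := by
  have hae : (quadrant ∩ A : Set (ℝ × ℝ)) =ᵐ[volume]
      ({b | 0 < b.1 ∧ 0 < b.2} ∩ A : Set (ℝ × ℝ)) := by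
    refine EventuallyEq.inter ?_ (ae_eq_refl _)
    refine ae_eq_set.2 ⟨volume_quadrant_sdiff, ?_⟩
    have hsub : {b : ℝ × ℝ | 0 < b.1 ∧ 0 < b.2} ⊆ quadrant := fun b hb => ⟨hb.1.le, hb.2.le⟩
    rw [sdiff_eq_empty.2 hsub, measure_empty]
  rw [setLIntegral_congr hae]
  let _ : Unique (Fin (0 + 1)) := inferInstanceAs (Unique (Fin 1))
  have hmp := volume_preserving_funUnique (Fin (0 + 1)) (ℝ × ℝ)
  have hpre := hmp.setLIntegral_comp_preimage_emb (MeasurableEquiv.measurableEmbedding _)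
    (fun a => ENNReal.ofReal (k / Real.Gamma k * (a.1 * a.2) ^ (k - 1) * Real.exp (-(a.1 * a.2))))
    ({b | 0 < b.1 ∧ 0 < b.2} ∩ A)
  rw [← hpre]
  have hset : decreasingTuples 0 ∩ {a | a 0 ∈ A} =
      (MeasurableEquiv.funUnique (Fin (0 + 1)) (ℝ × ℝ)) ⁻¹' ({b | 0 < b.1 ∧ 0 < b.2} ∩ A) := by
    have h0 : ∀ i : Fin (0 + 1), i = 0 := fun i => Fin.ext (by omega)
    ext a
    constructor
    · rintro ⟨⟨-, -, h1, h2⟩, h3⟩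
      exact ⟨⟨h1, h2⟩, h3⟩
    · rintro ⟨⟨h1, h2⟩, h3⟩
      refine ⟨⟨fun i j hij => ?_, fun i j hij => ?_, h1, h2⟩, h3⟩
      · rw [h0 i, h0 j] at hij
        exact absurd hij (lt_irrefl _)
      · rw [h0 i, h0 j] at hij
        exact absurd hij (lt_irrefl _)
  rw [hset]
  refine lintegral_congr fun a => ?_
  have ha : a = fun _ => a 0 := funext fun i => congrArg a (Fin.ext (by omega))
  rw [ha, ← Prod.mk.eta (p := a 0), cornerDensity_const]
  rfl

end Main

/-- Joint density of consecutive `k`-corners of the unit Poisson process in the quadrant, in the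
sense of expected numbers of tuples in an arbitrary measurable set; its symmetry; and the
intensity of the process of `k`-corners. -/
theorem mainTheorem4 {Ω : Type*} [MeasurableSpace Ω] (μ : Measure Ω) [IsProbabilityMeasure μ]
    (P : Ω → Set (ℝ × ℝ))
    (hP : IsPoissonPointProcess P ((volume : Measure (ℝ × ℝ)).restrict quadrant) μ)
    (k : ℕ) (hk : 1 ≤ k) :
    (∀ (n : ℕ) (B : Set (Fin (n + 1) → ℝ × ℝ)), MeasurableSet B →
      AEMeasurable (fun ω => (consecutiveCorners k n (P ω) ∩ B).encard) μ ∧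
      ∫⁻ ω, ((consecutiveCorners k n (P ω) ∩ B).encard : ℝ≥0∞) ∂μ =
        ∫⁻ a in decreasingTuples n ∩ B, ENNReal.ofReal (cornerDensity k n a)) ∧
    (∀ (n : ℕ) (a : Fin (n + 1) → ℝ × ℝ),
      cornerDensity k n (swapTuple a) = cornerDensity k n a) ∧
    (∀ t x : ℝ, cornerDensity k 0 (fun _ => (t, x)) =
      k / Real.Gamma k * (t * x) ^ (k - 1) * Real.exp (-(t * x))) ∧
    (∀ A : Set (ℝ × ℝ), MeasurableSet A →
      AEMeasurable (fun ω => (corners k (P ω) ∩ A).encard) μ ∧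
      ∫⁻ ω, ((corners k (P ω) ∩ A).encard : ℝ≥0∞) ∂μ =
        ∫⁻ a in quadrant ∩ A,
          ENNReal.ofReal (k / Real.Gamma k * (a.1 * a.2) ^ (k - 1) * Real.exp (-(a.1 * a.2)))) := by
  obtain ⟨p, rfl⟩ : ∃ p, k = p + 1 := ⟨k - 1, by omega⟩
  refine ⟨fun n B hB => hP.lintegral_consecutiveCorners p n hB, cornerDensity_swapTuple (p + 1),
    cornerDensity_const (p + 1), fun A hA => ?_⟩
  have hB : MeasurableSet {a : Fin (0 + 1) → ℝ × ℝ | a 0 ∈ A} := measurable_pi_apply 0 hA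
  have h := hP.lintegral_consecutiveCorners p 0 hB
  rw [lintegral_decreasingTuples_zero] at h
  simpa only [encard_corners_inter] using h
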